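/- Let $T=\mathbb F_2^4$, the group of two-torsion points $A[2]=\Gamma/2\Gamma$ of an abelian surface $A=\mathbb C^2/\Gamma$ in the coordinates of a basis $e_1,f_1,e_2,f_2$ of $\Gamma$ in which the polarization of type $(1,n)$ has class $e_1\wedge f_1+n\,e_2\wedge f_2$. Let $\varepsilon_0=\{v\in T: v_3=v_4=0\}$, $\varepsilon_1^*=\{v\in T: v_1=v_2=0\}$ and $\varepsilon_1=\varepsilon_0\,\triangle\,\varepsilon_1^*$; put $\varepsilon_{(n)}=\varepsilon_0$ for $n$ even and $\varepsilon_{(n)}=\varepsilon_1$ for $n$ odd. Let $E_v$ $(v\in T)$ be the sixteen exceptional classes of the Kummer surface, with $\langle E_v,E_{v'}\rangle=-2\delta_{vv'}$, and let $$K=\Big\{\sum_{v\in T}\tfrac{a_v}{2}E_v:\ a_v\in\mathbb Z,\ \{v: a_v \text{ odd}\}\text{ is empty, an affine 3-plane in } T,\text{ or all of }T\Big\}$$ be the Kummer lattice. For $w=\sum_v\frac{a_v}2E_v\in K$ write $w-\frac12\sum_{v\in\varepsilon_{(n)}}E_v=\sum_v\frac{b_v}{2}E_v$, with $b_v=b_v(w,n)\in\mathbb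 Z$. Let $N_d$ be the coefficient of $q^d$ in $q/\Delta(q)=\prod_{m\ge1}(1-q^m)^{-24}$, with $N_d=0$ for $d<0$ (the Yau--Zaslow numbers). Fix a sign $s\in\{1,-1\}$. The restricted genus $0$ orbifold Gromov--Witten potential of $[A/\pm1]$, summed over all $n\ge0$, as given by the crepant resolution conjecture, is $$F^{[A/\pm1]}(z,u)=\sum_{n\ge0}s^n u^n\sum_{w\in K}N_{1+\frac n2-\frac14\sum_v b_v^2}\,(-1)^{\frac12\sum_v b_v}\exp\Big(\tfrac i2\sum_{v\in T} b_vz_v\Big),$$ a power series in $u$ and $(z_v)_{v\in T}$ (each sum over $w$ has finitely many nonzero terms; all indices and exponents that occur are integers). Let $F(x,u)$ be the power series in $u$ and $(x_v)_{v\in T}$ obtained from it by the change of variables $x_v=2\sin(z_v/2)$, $v\in T$. Then for every $\mathbf k:T\to\mathbb Z_{\ge0}$, the coefficient of $\prod_{v\in T}x_v^{\mathbf k(v)}$ in $F$, which is a power series in $u$, is a quasimodular form of level $\Gamma_0(4)$ (in general of mixed weight). That is, with $u=e^{2\pi i\tau}$ it converges for all $\tau$ in the upper half plane, to an element of the $\mathbb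 C$-algebra generated by the Eisenstein series $E_2$ and the holomorphic modular forms of all integer weights for $\Gamma_0(4)$. -/

import Mathlib

open scoped BigOperators MatrixGroups

noncomputable section

namespace HyperellipticCount

/-- The group `A[2] = Γ / 2Γ` of two-torsion points of an abelian surface `A = ℂ² / Γ`, in the
coordinates given by a basis `e₁, f₁, e₂, f₂` of `Γ` (in this order) in which the polarization has
class `e₁ ∧ f₁ + n • (e₂ ∧ f₂)`. -/
abbrev TwoTorsion : Type := Fin 4 → ZMod 2

/-- The affine plane of two-torsion points on the image of the real plane spanned by `e₁, f₁`. -/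
def eps0 : Set TwoTorsion := {v | v 2 = 0 ∧ v 3 = 0}

/-- The affine plane of two-torsion points on the image of the real plane spanned by `e₂, f₂`. -/
def eps1Star : Set TwoTorsion := {v | v 0 = 0 ∧ v 1 = 0}

/-- The sum (symmetric difference) of the two planes. -/
def eps1 : Set TwoTorsion := symmDiff eps0 eps1Star

/-- The set attached to a polarization of type `(1, n)`; it depends on the parity of `n` only. -/
def eps (n : ℕ) : Set TwoTorsion := if Even n then eps0 else eps1

/-- The Kummer lattice. An integral vector `a` stands for the class `w = ∑ v, (a v / 2) E_v`, where
the `E_v` are the sixteen exceptional `(-2)`-curves; `w` is in the lattice when the set of `v` with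
`a v` odd is empty, an affine 3-plane of `A[2]`, or all of `A[2]`. -/
def kummerLattice : Set (TwoTorsion → ℤ) :=
  {a | {v | Odd (a v)} = ∅ ∨
    (∃ P : AffineSubspace (ZMod 2) TwoTorsion,
      Module.finrank (ZMod 2) P.direction = 3 ∧ {v | Odd (a v)} = (P : Set TwoTorsion)) ∨
    {v | Odd (a v)} = Set.univ}

open Classical in
/-- The integers `b v` with `w - ∑ v ∈ eps n, E_v / 2 = ∑ v, (b v / 2) E_v`. -/
def shifted (n : ℕ) (a : TwoTorsion → ℤ) (v : TwoTorsion) : ℤ :=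
  a v - if v ∈ eps n then 1 else 0

/-- The self-intersection of the class `β = H_n / 2 + w - ∑ v ∈ eps n, E_v / 2` on the Kummer
surface, where `H_n² = 4 n`, the class `H_n` is orthogonal to every `E_v`, and
`E_v · E_v' = -2` if `v = v'` and `0` otherwise. -/
def classSq (n : ℕ) (a : TwoTorsion → ℤ) : ℚ :=
  (n : ℚ) - (1 / 2) * ∑ v, (shifted n a v : ℚ) ^ 2

/-- The coefficient of `q ^ d` in `q / Δ(q) = ∏_{k ≥ 1} (1 - q ^ k) ^ (-24)`. Factors with `k > d`
do not contribute to it. -/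
def yauZaslow (d : ℕ) : ℂ :=
  PowerSeries.coeff d
    ((∏ k ∈ Finset.Icc 1 d, (1 - (PowerSeries.X : PowerSeries ℂ) ^ k) ^ 24)⁻¹)

open Classical in
/-- The reduced genus 0 Gromov-Witten invariant of a K3 surface in a primitive class of
self-intersection `s`, as given by the Yau-Zaslow formula: it is the coefficient of `q ^ d` in
`q / Δ(q)` if `s = 2 d - 2` for a natural number `d`, and zero otherwise. -/
def k3Invariant (s : ℚ) : ℂ :=
  if h : ∃ d : ℕ, s = 2 * (d : ℚ) - 2 then yauZaslow h.choose else 0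

/-- The formal power series `∏ v, exp (c v * z_v)` in the sixteen variables `z_v`. -/
def expSeries (c : TwoTorsion → ℂ) : MvPowerSeries TwoTorsion ℂ :=
  fun m => ∏ v, c v ^ m v / ((m v).factorial : ℂ)

/-- The summand of `w` (given by `a`) in the coefficient of `u ^ n` of the orbifold potential. The
crepant resolution substitution replaces `y_v` by `i z_v`, so that `exp ((b v / 2) y_v)` becomes
`exp ((i b v / 2) z_v)`, and `q ^ (∑ v, (b v / 2) E_v)` by `(-1) ^ (∑ v, b v / 2)`; here
`∑ v, b v` is even. -/
def orbTerm (n : ℕ) (a : TwoTorsion → ℤ) : MvPowerSeries TwoTorsion ℂ :=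
  (k3Invariant (classSq n a) * (-1 : ℂ) ^ ((∑ v, shifted n a v) / 2)) •
    expSeries fun v => Complex.I * (shifted n a v : ℂ) / 2

/-- The coefficient of `u ^ n` of the restricted genus 0 orbifold potential of `[A/±1]`, a power
series in the variables `z_v`. The sign `s` is the root of unity in the substitution
`u ↦ s u` for the fibre variable. Only finitely many summands are nonzero, see
`finite_support_orbTerm`. -/
def orbPotential (s : ℤˣ) (n : ℕ) : MvPowerSeries TwoTorsion ℂ :=
  (((s : ℤ) : ℂ) ^ n) • ∑ᶠ a : kummerLattice, orbTerm n a

theorem finite_support_orbTerm (n : ℕ) :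
    (Function.support fun a : kummerLattice => orbTerm n a).Finite := by
  have hfin : (Set.pi Set.univ fun _ : TwoTorsion =>
      Set.Icc (-(2 * (n : ℤ) + 5)) (2 * (n : ℤ) + 5)).Finite :=
    Set.Finite.pi fun _ => Set.finite_Icc _ _
  refine Set.Finite.of_finite_image (hfin.subset ?_) Subtype.val_injective.injOn
  rintro _ ⟨⟨a, ha⟩, h, rfl⟩ v -
  have h1 : k3Invariant (classSq n a) ≠ 0 := by
    intro h0
    exact h (by simp [orbTerm, h0])
  have h2 : ∃ d : ℕ, classSq n a = 2 * (d : ℚ) - 2 := by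
    by_contra h0
    exact h1 (by simp [k3Invariant, h0])
  obtain ⟨d, hd⟩ := h2
  have h3 : (shifted n a v : ℚ) ^ 2 ≤ ∑ v, (shifted n a v : ℚ) ^ 2 :=
    Finset.single_le_sum (f := fun v => (shifted n a v : ℚ) ^ 2)
      (fun _ _ => sq_nonneg _) (Finset.mem_univ v)
  have h4 : (0 : ℚ) ≤ d := Nat.cast_nonneg d
  have h5 : (shifted n a v : ℚ) ^ 2 ≤ 2 * n + 4 := by
    unfold classSq at hd
    linarith
  have h6 : (shifted n a v) ^ 2 ≤ 2 * (n : ℤ) + 4 := by exact_mod_cast h5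
  have h7 : -(2 * (n : ℤ) + 4) ≤ shifted n a v ∧ shifted n a v ≤ 2 * (n : ℤ) + 4 := by
    constructor <;> nlinarith
  unfold shifted at h7
  show -(2 * (n : ℤ) + 5) ≤ a v ∧ a v ≤ 2 * (n : ℤ) + 5
  split_ifs at h7 <;> constructor <;> linarith [h7.1, h7.2]

/-- The formal power series `2 sin (z / 2)`. -/
def twoSinHalf : PowerSeries ℂ :=
  (2 : ℂ) • PowerSeries.rescale (1 / 2 : ℂ) (PowerSeries.sin ℂ)

theorem constantCoeff_twoSinHalf : PowerSeries.constantCoeff twoSinHalf = 0 := by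
  rw [← PowerSeries.coeff_zero_eq_constantCoeff_apply]
  simp [twoSinHalf, PowerSeries.sin]

theorem isUnit_coeff_one_twoSinHalf : IsUnit (PowerSeries.coeff 1 twoSinHalf) := by
  simp [twoSinHalf, PowerSeries.sin, PowerSeries.coeff_rescale]

/-- The compositional inverse `z(x)` of `x = 2 sin (z / 2)`. -/
def twoSinHalfInv : PowerSeries ℂ :=
  PowerSeries.substInvOfIsUnit twoSinHalf isUnit_coeff_one_twoSinHalf

/-- The generating function `F(x, u)` as a power series in `u` over the power series in the sixteen
variables `x_v`: the orbifold potential after the change of variables `x_v = 2 sin (z_v / 2)`. -/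
def F (s : ℤˣ) : PowerSeries (MvPowerSeries TwoTorsion ℂ) :=
  PowerSeries.mk fun n =>
    MvPowerSeries.subst
      (fun v => PowerSeries.subst (MvPowerSeries.X v : MvPowerSeries TwoTorsion ℂ) twoSinHalfInv)
      (orbPotential s n)

/-- The coefficient, a power series in `u`, of the monomial `∏ v, x_v ^ k v` in `F`. -/
def monomialCoeff (s : ℤˣ) (k : TwoTorsion →₀ ℕ) : PowerSeries ℂ :=
  PowerSeries.mk fun n => MvPowerSeries.coeff k (PowerSeries.coeff n (F s))

/-- The ring of quasimodular forms (of mixed weight) for a finite index subgroup `Γ` of `SL(2, ℤ)`: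
the algebra of functions on the upper half plane generated by the holomorphic modular forms of all
weights for `Γ` and the Eisenstein series `E₂`. -/
def quasimodularRing (Γ : Subgroup SL(2, ℤ)) : Subalgebra ℂ (UpperHalfPlane → ℂ) :=
  Algebra.adjoin ℂ
    ({f | ∃ (k : ℤ) (g : ModularForm (Γ.map (Matrix.SpecialLinearGroup.mapGL ℝ)) k), f = ⇑g} ∪
      {EisensteinSeries.E2})

/-- The power series `G(u)` converges for `u = exp (2 π i τ)`, `τ` in the upper half plane, to a
quasimodular form for `Γ`. -/
def IsQuasimodular (Γ : Subgroup SL(2, ℤ)) (G : PowerSeries ℂ) : Prop :=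
  ∃ f ∈ quasimodularRing Γ, ∀ τ : UpperHalfPlane,
    HasSum (fun n : ℕ => PowerSeries.coeff n G *
      Complex.exp (2 * Real.pi * Complex.I * (τ : ℂ)) ^ n) (f τ)

end HyperellipticCount

end

/-! Since the inverse of `x = 2 sin (z/2)` has no constant term, a coefficient in the `x_v` is a
finite combination, with constants independent of `n`, of coefficients in the `z_v`; it suffices to
treat the latter. The term of `b` with Yau-Zaslow index `d` sits at `n = 2d - 2 + ½ ∑ b_v²`, and
`(-1)^(½ ∑ b_v) = ∏ i^(b_v)`. Hence, once the set `O` of odd entries of `b` is fixed, the sum over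
`d` and `b` factors (`hasSum_orbSum_mul_pow`): it is a constant times `η(2τ)^(-24)` times a product
over `v` of theta moments `∑ i^b b^j u^(b²/2)`, with `b` even or odd according to whether `v ∈ O`.

A moment of the wrong parity vanishes, and two more powers of `b` amount to one derivative
(`thetaMoment_add_two`). Each moment is therefore a quasimodular multiple of a base moment:
`η(2τ)²/η(4τ)` for even `b` (`thetaMoment_false_zero_mul`) and `2i η(4τ)³` for odd `b`
(`thetaMoment_true_one`). These product formulas come from finite q-binomial identities by passing
to the limit. The multipliers lie in the ring generated by level one forms and `E₂` at `Nτ`, `N ∣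
4`, which is closed under differentiation (`scaledRing_mdifferentiable_and_deriv`) and lies in the
quasimodular ring of `Γ₀(4)` (`scaledRing_le`).

If `|O| = 2h`, the base moments and `η(2τ)^(-24)` combine to a constant times
`(η(4τ)^8/η(2τ)^4)^(h-2)`. The affine geometry of the Kummer lattice gives `h ≥ 2`
(`card_symmDiff_affineSet`), so no negative power occurs, and a Wronskian of two theta functions
writes this eta quotient as a combination of `E₂(τ)`, `E₂(2τ)`, `E₂(4τ)` (`etaQuot_eq`). Finally `h
≡ n mod 2`, so the sign `s^n` depends on `O` only. -/

noncomputable section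

namespace HyperellipticCount

/-! ### Gaussian binomials and finite forms of Jacobi's identities -/

section GaussBinom

/-- The Gaussian binomial coefficient. -/
def gaussBinom (q : ℂ) : ℕ → ℕ → ℂ
  | _, 0 => 1
  | 0, _ + 1 => 0
  | n + 1, k + 1 => gaussBinom q n k + q ^ (k + 1) * gaussBinom q n (k + 1)

/-- The finite product `(q; q)_n`. -/
def qPoch (q : ℂ) (n : ℕ) : ℂ := ∏ j ∈ Finset.range n, (1 - q ^ (j + 1))

theorem gaussBinom_zero_right (q : ℂ) (n : ℕ) : gaussBinom q n 0 = 1 := by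
  cases n <;> rfl

theorem gaussBinom_succ_succ (q : ℂ) (n k : ℕ) :
    gaussBinom q (n + 1) (k + 1) = gaussBinom q n k + q ^ (k + 1) * gaussBinom q n (k + 1) := rfl

theorem gaussBinom_eq_zero (q : ℂ) {n k : ℕ} (h : n < k) : gaussBinom q n k = 0 := by
  induction n generalizing k with
  | zero => obtain ⟨k, rfl⟩ := Nat.exists_eq_succ_of_ne_zero h.ne'; rfl
  | succ n ih =>
    obtain ⟨k, rfl⟩ := Nat.exists_eq_succ_of_ne_zero (by omega : k ≠ 0)
    rw [Nat.succ_eq_add_one, gaussBinom_succ_succ, ih (by omega), ih (by omega)]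
    simp

/-- Double induction with the q-Pascal rule and `1 - q^(k+l+2) = (1 - q^(k+1)) + q^(k+1) (1 -
q^(l+1))`. Being free of division, it needs no condition on `q`. -/
theorem gaussBinom_mul_qPoch (q : ℂ) (k l : ℕ) :
    gaussBinom q (k + l) k * (qPoch q k * qPoch q l) = qPoch q (k + l) := by
  induction k generalizing l with
  | zero => simp [gaussBinom_zero_right, qPoch]
  | succ k ihk =>
    induction l with
    | zero =>
      have h := ihk 0
      rw [add_zero] at h
      rw [add_zero, gaussBinom_succ_succ, gaussBinom_eq_zero q (Nat.lt_succ_self k)]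
      simp only [qPoch, Finset.prod_range_succ, Finset.range_zero, Finset.prod_empty] at h ⊢
      linear_combination (1 - q ^ (k + 1)) * h
    | succ l ihl =>
      have h := ihk (l + 1)
      rw [show k + 1 + (l + 1) = (k + 1 + l) + 1 by ring, gaussBinom_succ_succ]
      rw [show k + (l + 1) = k + 1 + l by ring] at h
      have e (m : ℕ) : qPoch q (m + 1) = qPoch q m * (1 - q ^ (m + 1)) := by
        simp [qPoch, Finset.prod_range_succ]
      rw [e k] at ihl ⊢
      rw [e l] at h ⊢
      rw [e (k + 1 + l), ← ihl]
      rw [← ihl] at h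
      have h2 : q ^ (k + 1 + l + 1) = q ^ (k + 1) * q ^ (l + 1) := by ring
      rw [h2]
      linear_combination (1 - q ^ (k + 1)) * h

/-- The q-binomial theorem. Splitting off the factor `1 + x` leaves the shorter product at `x * q`,
so the induction has to vary `x`. -/
theorem prod_one_add_mul_pow (q x : ℂ) (n : ℕ) :
    ∏ k ∈ Finset.range n, (1 + x * q ^ k) =
      ∑ k ∈ Finset.range (n + 1), q ^ (k.choose 2) * gaussBinom q n k * x ^ k := by
  induction n generalizing x with
  | zero => simp [gaussBinom_zero_right]
  | succ n ih =>
    rw [Finset.prod_range_succ']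
    have h1 : ∏ k ∈ Finset.range n, (1 + x * q ^ (k + 1)) =
        ∏ k ∈ Finset.range n, (1 + (x * q) * q ^ k) :=
      Finset.prod_congr rfl fun k _ => by ring
    rw [h1, ih, Finset.sum_range_succ' _ (n + 1)]
    have h2 : ∑ k ∈ Finset.range (n + 1), q ^ ((k + 1).choose 2) * gaussBinom q (n + 1) (k + 1) *
        x ^ (k + 1) = x * (∑ k ∈ Finset.range (n + 1), q ^ (k.choose 2) * gaussBinom q n k *
          (x * q) ^ k) + ∑ k ∈ Finset.range (n + 1), q ^ ((k + 1).choose 2) *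
            gaussBinom q n (k + 1) * (x * q) ^ (k + 1) := by
      rw [Finset.mul_sum, ← Finset.sum_add_distrib]
      refine Finset.sum_congr rfl fun k _ => ?_
      rw [gaussBinom_succ_succ, Nat.choose_succ_succ' k 1, Nat.choose_one_right]
      ring
    rw [h2]
    have h3 := Finset.sum_range_succ' (fun k => q ^ (k.choose 2) * gaussBinom q n k * (x * q) ^ k)
      (n + 1)
    rw [Finset.sum_range_succ, gaussBinom_eq_zero q (Nat.lt_succ_self n)] at h3
    simp only [gaussBinom_zero_right, mul_zero, zero_mul, add_zero, Nat.choose_zero_succ, pow_zero,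
      mul_one] at h3 ⊢
    rw [← sub_eq_iff_eq_add] at h3
    rw [← h3]
    ring

theorem two_mul_choose_two (k : ℕ) : (2 * (k.choose 2 : ℕ) : ℤ) = k * (k - 1) := by
  induction k with
  | zero => simp
  | succ k ih =>
    rw [Nat.choose_succ_succ' k 1, Nat.choose_one_right]
    push_cast
    linarith

/-- A finite form of the Jacobi triple product identity at `ζ = ±1`. -/
theorem sum_sign_gaussBinom {q ζ : ℂ} (hq : q ≠ 0) (hζ : ζ ^ 2 = 1) (n : ℕ) :
    ∑ k ∈ Finset.range (2 * n + 1), ζ ^ (k + n) * q ^ (((k : ℤ) - n) ^ 2) *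
      gaussBinom (q ^ 2) (2 * n) k = (∏ j ∈ Finset.range n, (1 + ζ * q ^ (2 * j + 1))) ^ 2 := by
  -- With this `x` the factors are `1 + ζ q^e` for odd `e` from `1 - 2n` to `2n - 1`. The negative
  -- half folds onto the positive one by `1 + ζ q^(-e) = ζ q^(-e) (1 + ζ q^e)`, which uses `ζ² = 1`.
  have h := prod_one_add_mul_pow (q ^ 2) (ζ * q ^ (1 - 2 * n : ℤ)) (2 * n)
  have h1 : ∏ k ∈ Finset.range n, (1 + ζ * q ^ (1 - 2 * n : ℤ) * (q ^ 2) ^ k) =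
      ζ ^ n * q ^ (-(n : ℤ) ^ 2) * ∏ j ∈ Finset.range n, (1 + ζ * q ^ (2 * j + 1)) := by
    rw [← Finset.prod_range_reflect]
    have : ζ ^ n * q ^ (-(n : ℤ) ^ 2) = ∏ j ∈ Finset.range n, (ζ * q ^ (-(2 * j + 1) : ℤ)) := by
      clear h
      induction n with
      | zero => simp
      | succ n ih =>
        rw [Finset.prod_range_succ, ← ih, mul_mul_mul_comm, ← zpow_add₀ hq, pow_succ]
        congr 2
        push_cast
        ring
    rw [this, ← Finset.prod_mul_distrib]
    refine Finset.prod_congr rfl fun j hj => ?_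
    have hj' : j < n := Finset.mem_range.mp hj
    have e1 : (q ^ 2) ^ (n - 1 - j) = q ^ (2 * n - 2 - 2 * j : ℤ) := by
      rw [← pow_mul, ← zpow_natCast]
      congr 1
      omega
    have e2 : q ^ (2 * j + 1) = q ^ (2 * j + 1 : ℤ) := by
      rw [← zpow_natCast]; congr 1
    have e3 : q ^ (1 - 2 * n : ℤ) * q ^ (2 * n - 2 - 2 * j : ℤ) = q ^ (-(2 * j + 1) : ℤ) := by
      rw [← zpow_add₀ hq]
      congr 1
      ring
    have e4 : q ^ (-(2 * j + 1) : ℤ) * q ^ (2 * j + 1 : ℤ) = 1 := by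
      rw [← zpow_add₀ hq, neg_add_cancel, zpow_zero]
    rw [e1, e2]
    linear_combination ζ * e3 - ζ ^ 2 * e4 - hζ
  have h2 : ∏ k ∈ Finset.range n, (1 + ζ * q ^ (1 - 2 * n : ℤ) * (q ^ 2) ^ (n + k)) =
      ∏ j ∈ Finset.range n, (1 + ζ * q ^ (2 * j + 1)) := by
    refine Finset.prod_congr rfl fun j hj => ?_
    rw [← pow_mul, ← zpow_natCast q (2 * (n + j)), mul_assoc, ← zpow_add₀ hq,
      ← zpow_natCast q (2 * j + 1)]
    congr 3
    push_cast
    ring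
  rw [two_mul n, Finset.prod_range_add, ← two_mul n, h1, h2] at h
  have h3 : (ζ ^ n * q ^ ((n : ℤ) ^ 2)) * (ζ ^ n * q ^ (-(n : ℤ) ^ 2)) = 1 := by
    rw [mul_mul_mul_comm, ← zpow_add₀ hq, ← mul_pow, ← pow_two, hζ]
    simp
  calc _ = (ζ ^ n * q ^ ((n : ℤ) ^ 2)) * ∑ k ∈ Finset.range (2 * n + 1),
        (q ^ 2) ^ (k.choose 2) * gaussBinom (q ^ 2) (2 * n) k * (ζ * q ^ (1 - 2 * n : ℤ)) ^ k := by
        rw [Finset.mul_sum]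
        refine Finset.sum_congr rfl fun k _ => ?_
        have e : q ^ (((k : ℤ) - n) ^ 2) = q ^ ((n : ℤ) ^ 2) * (q ^ 2) ^ (k.choose 2) *
            (q ^ (1 - 2 * n : ℤ)) ^ k := by
          rw [← pow_mul, ← zpow_natCast q (2 * _), ← zpow_natCast (q ^ (1 - 2 * n : ℤ)),
            ← zpow_mul, ← zpow_add₀ hq, ← zpow_add₀ hq]
          congr 1
          have hc := two_mul_choose_two k
          push_cast
          rw [hc]
          ring
        rw [e, mul_pow]
        ring
    _ = _ := by
      rw [← h, ← mul_assoc, ← mul_assoc, h3]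
      ring

/-- A finite form of Jacobi's formula for the cube of the Euler product. -/
theorem sum_linear_gaussBinom {q : ℂ} (hq : q ≠ 0) (n : ℕ) :
    ∑ k ∈ Finset.range (2 * n + 2), ((n : ℂ) + 1 - k) * ((-1) ^ (k + n) *
      (q ^ (k.choose 2) * q ^ (-((n * k : ℕ) : ℤ)) * q ^ ((n + 1).choose 2)) *
      gaussBinom q (2 * n + 1) k) = qPoch q n ^ 2 := by
  -- The zero of the middle factor `1 + x q^n` of a product of `2n + 1` factors. There the
  -- derivative only sees the other factors; since the sum itself vanishes at `x₀`, the weight `k`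
  -- from `x d/dx` may be replaced by `n + 1 - k` up to sign.
  set x₀ : ℂ := -q ^ (-(n : ℤ)) with hx₀
  have hx0 : x₀ * q ^ n = -1 := by
    rw [hx₀, zpow_neg, zpow_natCast]
    field_simp
  have hP (x : ℂ) : (∏ k ∈ Finset.range n, (1 + x * q ^ k)) * (1 + x * q ^ n) *
      ∏ k ∈ Finset.range n, (1 + x * q ^ (n + 1 + k)) =
      ∑ k ∈ Finset.range (2 * n + 2), q ^ (k.choose 2) * gaussBinom q (2 * n + 1) k * x ^ k := by
    rw [← prod_one_add_mul_pow, show 2 * n + 1 = (n + 1) + n by ring, Finset.prod_range_add,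
      Finset.prod_range_succ]
  have hval : ∑ k ∈ Finset.range (2 * n + 2),
      q ^ (k.choose 2) * gaussBinom q (2 * n + 1) k * x₀ ^ k = 0 := by
    rw [← hP, hx0]; simp
  have hd1 : HasDerivAt (fun x : ℂ => ∑ k ∈ Finset.range (2 * n + 2),
      q ^ (k.choose 2) * gaussBinom q (2 * n + 1) k * x ^ k)
      (∑ k ∈ Finset.range (2 * n + 2),
        q ^ (k.choose 2) * gaussBinom q (2 * n + 1) k * (k * x₀ ^ (k - 1))) x₀ :=
    HasDerivAt.fun_sum fun k _ => (hasDerivAt_pow k x₀).const_mul _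
  set G : ℂ → ℂ := fun x => (∏ k ∈ Finset.range n, (1 + x * q ^ k)) *
    ∏ k ∈ Finset.range n, (1 + x * q ^ (n + 1 + k)) with hG
  have hGd : DifferentiableAt ℂ G x₀ := by
    rw [hG]; fun_prop
  have hd2 : HasDerivAt (fun x : ℂ => (1 + x * q ^ n) * G x) (q ^ n * G x₀) x₀ := by
    have h := (((hasDerivAt_id x₀).mul_const (q ^ n)).const_add 1).mul hGd.hasDerivAt
    simp only [id, one_mul, hx0, add_neg_cancel, zero_mul, add_zero] at h
    exact h
  have hEq : (fun x : ℂ => (1 + x * q ^ n) * G x) = fun x : ℂ => ∑ k ∈ Finset.range (2 * n + 2),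
      q ^ (k.choose 2) * gaussBinom q (2 * n + 1) k * x ^ k := by
    funext x; rw [← hP, hG]; ring
  rw [hEq] at hd2
  have hder := congrArg (x₀ * ·) (hd1.unique hd2)
  simp only [Finset.mul_sum] at hder
  rw [← mul_assoc, hx0] at hder
  have hG0 : G x₀ * q ^ ((n + 1).choose 2) = (-1) ^ n * qPoch q n ^ 2 := by
    have h1 : (∏ k ∈ Finset.range n, (1 + x₀ * q ^ (n + 1 + k))) = qPoch q n :=
      Finset.prod_congr rfl fun k _ => by
        rw [show x₀ * q ^ (n + 1 + k) = (x₀ * q ^ n) * q ^ (k + 1) by ring, hx0]; ring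
    have h2 : (∏ k ∈ Finset.range n, (1 + x₀ * q ^ k)) * q ^ ((n + 1).choose 2) =
        (-1) ^ n * qPoch q n := by
      have : q ^ ((n + 1).choose 2) = ∏ k ∈ Finset.range n, q ^ (k + 1) := by
        rw [Finset.prod_pow_eq_pow_sum, Finset.sum_add_distrib, Finset.sum_range_id,
          Nat.choose_succ_succ' n 1, Nat.choose_one_right, Nat.choose_two_right]
        simp [add_comm]
      rw [this, ← Finset.prod_range_reflect, ← Finset.prod_mul_distrib, qPoch,
        show (-1 : ℂ) ^ n = ∏ k ∈ Finset.range n, (-1 : ℂ) by simp, ← Finset.prod_mul_distrib]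
      refine Finset.prod_congr rfl fun k hk => ?_
      have hk' : k < n := Finset.mem_range.mp hk
      have : x₀ * q ^ (n - 1 - k) * q ^ (k + 1) = -1 := by
        rw [mul_assoc, ← pow_add, show n - 1 - k + (k + 1) = n by omega, hx0]
      linear_combination this
    rw [hG]
    simp only
    rw [h1]
    linear_combination qPoch q n * h2
  have key : ∑ k ∈ Finset.range (2 * n + 2), ((n : ℂ) + 1 - k) *
      (q ^ (k.choose 2) * gaussBinom q (2 * n + 1) k * x₀ ^ k) = G x₀ := by
    have : ∀ k ∈ Finset.range (2 * n + 2), ((n : ℂ) + 1 - k) *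
      (q ^ (k.choose 2) * gaussBinom q (2 * n + 1) k * x₀ ^ k) =
        ((n : ℂ) + 1) * (q ^ (k.choose 2) * gaussBinom q (2 * n + 1) k * x₀ ^ k) -
        x₀ * (q ^ (k.choose 2) * gaussBinom q (2 * n + 1) k * (k * x₀ ^ (k - 1))) := by
      intro k _
      rcases k with _ | k
      · simp
      · rw [Nat.add_sub_cancel]; ring
    rw [Finset.sum_congr rfl this, Finset.sum_sub_distrib, ← Finset.mul_sum, hval, hder]
    ring
  have hs : ((-1 : ℂ) ^ n) * (-1) ^ n = 1 := by rw [← mul_pow]; simp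
  calc _ = ((-1) ^ n * q ^ ((n + 1).choose 2)) * ∑ k ∈ Finset.range (2 * n + 2),
        ((n : ℂ) + 1 - k) * (q ^ (k.choose 2) * gaussBinom q (2 * n + 1) k * x₀ ^ k) := by
        rw [Finset.mul_sum]
        refine Finset.sum_congr rfl fun k _ => ?_
        have : x₀ ^ k = (-1) ^ k * q ^ (-((n * k : ℕ) : ℤ)) := by
          rw [hx₀, neg_pow, ← zpow_natCast (q ^ (-(n : ℤ))), ← zpow_mul]
          push_cast
          rw [neg_mul]
        rw [this]
        ring
    _ = _ := by
      rw [key]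
      linear_combination (-1) ^ n * hG0 + qPoch q n ^ 2 * hs

end GaussBinom

/-! ### The Euler product and passage to the limit in the finite identities -/

section EulerProduct

open Filter Topology

/-- The Euler product `∏ (1 - q ^ n)`. -/
def eulerProd (q : ℂ) : ℂ := ∏' n : ℕ, (1 - q ^ (n + 1))

theorem one_sub_pow_ne_zero {q : ℂ} (hq : ‖q‖ < 1) (n : ℕ) : 1 - q ^ (n + 1) ≠ 0 := by
  intro h
  have : ‖q ^ (n + 1)‖ < 1 := by
    rw [norm_pow]; exact pow_lt_one₀ (norm_nonneg _) hq (by omega)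
  rw [← sub_eq_zero.mp h] at this
  simp at this

theorem eulerProd_ne_zero {q : ℂ} (hq : ‖q‖ < 1) : eulerProd q ≠ 0 := by
  have h := tprod_one_add_ne_zero_of_summable (f := fun n : ℕ => -q ^ (n + 1))
    (fun n => by simpa [sub_eq_add_neg] using one_sub_pow_ne_zero hq n)
    (by simpa using (summable_nat_add_iff 1).mpr (summable_geometric_of_lt_one (norm_nonneg _) hq))
  simpa [eulerProd, sub_eq_add_neg] using h

theorem tendsto_qPoch {q : ℂ} (hq : ‖q‖ < 1) :
    Tendsto (qPoch q) atTop (𝓝 (eulerProd q)) :=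
  (ModularForm.multipliable_one_sub_pow hq).hasProd.tendsto_prod_nat

theorem qPoch_ne_zero {q : ℂ} (hq : ‖q‖ < 1) (n : ℕ) : qPoch q n ≠ 0 :=
  Finset.prod_ne_zero_iff.mpr fun j _ => one_sub_pow_ne_zero hq j

theorem gaussBinom_eq_div {q : ℂ} (hq : ‖q‖ < 1) (k l : ℕ) :
    gaussBinom q (k + l) k = qPoch q (k + l) * ((qPoch q k)⁻¹ * (qPoch q l)⁻¹) := by
  rw [← gaussBinom_mul_qPoch]
  have := qPoch_ne_zero hq k
  have := qPoch_ne_zero hq l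
  field_simp

/-- The finite products `(q; q)_n` and their inverses converge, the limit being nonzero, hence are
bounded. The constant serves for dominated convergence. -/
theorem exists_norm_gaussBinom_le {q : ℂ} (hq : ‖q‖ < 1) :
    ∃ C : ℝ, 0 ≤ C ∧ ∀ n k, ‖gaussBinom q n k‖ ≤ C := by
  obtain ⟨A, hA⟩ := (tendsto_qPoch hq).norm.bddAbove_range
  obtain ⟨B, hB⟩ := ((tendsto_qPoch hq).inv₀ (eulerProd_ne_zero hq)).norm.bddAbove_range
  have hA' (n) : ‖qPoch q n‖ ≤ A := hA ⟨n, rfl⟩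
  have hB' (n) : ‖(qPoch q n)⁻¹‖ ≤ B := hB ⟨n, rfl⟩
  have hA0 : 0 ≤ A := (norm_nonneg _).trans (hA' 0)
  have hB0 : 0 ≤ B := (norm_nonneg _).trans (hB' 0)
  refine ⟨A * (B * B), by positivity, fun n k => ?_⟩
  rcases lt_or_ge n k with h | h
  · rw [gaussBinom_eq_zero q h, norm_zero]; positivity
  · obtain ⟨l, rfl⟩ := Nat.exists_eq_add_of_le h
    rw [gaussBinom_eq_div hq, norm_mul, norm_mul]
    gcongr
    exacts [hA' _, hB' _, hB' _]

theorem tendsto_gaussBinom {q : ℂ} (hq : ‖q‖ < 1) {f g : ℕ → ℕ} (hf : Tendsto f atTop atTop)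
    (hg : Tendsto g atTop atTop) :
    Tendsto (fun n => gaussBinom q (f n + g n) (f n)) atTop (𝓝 (eulerProd q)⁻¹) := by
  simp_rw [gaussBinom_eq_div hq]
  have h0 := eulerProd_ne_zero hq
  have hp := tendsto_qPoch hq
  have h1 := (hp.comp (hf.atTop_add_atTop hg)).mul
    (((hp.comp hf).inv₀ h0).mul ((hp.comp hg).inv₀ h0))
  convert! h1 using 2
  field_simp

/-- Recentring by `m = k - n` puts the finite sums on the fixed index set `ℤ`. Beyond `N` the
Gaussian binomial vanishes by itself; below zero `toNat` would clamp, hence the explicit cutoff. -/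
theorem tsum_shift_gaussBinom (q : ℂ) (N n : ℕ) (a : ℤ → ℂ) :
    ∑' m : ℤ, (if 0 ≤ m + n then a m * gaussBinom q N (m + n).toNat else 0) =
      ∑ k ∈ Finset.range (N + 1), a (k - n) * gaussBinom q N k := by
  have hinj : Function.Injective (fun k : ℕ => (k : ℤ) - n) := fun a b h => by simpa using h
  rw [← hinj.tsum_eq]
  · rw [tsum_eq_sum (s := Finset.range (N + 1))]
    · refine Finset.sum_congr rfl fun k _ => ?_
      simp
    · intro k hk
      have : N < k := by simpa [Nat.lt_succ_iff] using hk
      simp [gaussBinom_eq_zero q this]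
  · intro m hm
    have : 0 ≤ m + n := by
      by_contra h
      simp [h] at hm
    exact ⟨(m + n).toNat, by simp [this]⟩

theorem tendsto_sum_gaussBinom {q : ℂ} (hq : ‖q‖ < 1) (e : ℕ) {a : ℤ → ℂ}
    (ha : Summable fun m => ‖a m‖) :
    Tendsto (fun n : ℕ => ∑ k ∈ Finset.range (2 * n + e + 1), a (k - n) *
      gaussBinom q (2 * n + e) k) atTop (𝓝 ((∑' m, a m) * (eulerProd q)⁻¹)) := by
  obtain ⟨C, hC0, hC⟩ := exists_norm_gaussBinom_le hq
  simp_rw [← tsum_shift_gaussBinom, ← tsum_mul_right]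
  refine tendsto_tsum_of_dominated_convergence (ha.mul_right C) (fun m => ?_)
    (Eventually.of_forall fun n m => ?_)
  · have hf : Tendsto (fun n : ℕ => (m + n).toNat) atTop atTop :=
      tendsto_atTop.mpr fun b => eventually_atTop.mpr ⟨b + m.natAbs, fun n hn => by omega⟩
    have hg : Tendsto (fun n : ℕ => (n + e - m).toNat) atTop atTop :=
      tendsto_atTop.mpr fun b => eventually_atTop.mpr ⟨b + m.natAbs, fun n hn => by omega⟩
    refine ((tendsto_gaussBinom hq hf hg).const_mul (a m)).congr' ?_
    refine eventually_atTop.mpr ⟨m.natAbs, fun n hn => ?_⟩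
    dsimp only
    rw [if_pos (by omega)]
    congr 2
    omega
  · split_ifs
    · rw [norm_mul]
      gcongr
      exact hC _ _
    · simp; positivity

theorem summable_pow_mul_norm_zpow_sq {q : ℂ} (hq0 : q ≠ 0) (hq : ‖q‖ < 1) (j : ℕ) :
    Summable fun m : ℤ => (|m| ^ j : ℝ) * ‖q ^ (m ^ 2)‖ := by
  have hpos : 0 < ‖q‖ := norm_pos_iff.mpr hq0
  have hT : 0 < -Real.log ‖q‖ / Real.pi :=
    div_pos (neg_pos.mpr (Real.log_neg hpos hq)) Real.pi_pos
  refine (summable_pow_mul_jacobiTheta₂_term_bound 0 hT j).congr fun m => ?_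
  congr 1
  rw [norm_zpow, ← Real.rpow_intCast, Real.rpow_def_of_pos hpos]
  congr 1
  push_cast
  field_simp
  ring

/-- The limit of `sum_sign_gaussBinom`: the central Gaussian binomials tend to the inverse of
`eulerProd (q ^ 2)`, which moves to the other side. -/
theorem tsum_sign_zpow_sq {q ζ : ℂ} (hq0 : q ≠ 0) (hq : ‖q‖ < 1) (hζ : ζ ^ 2 = 1) :
    ∑' m : ℤ, ζ ^ m * q ^ (m ^ 2) =
      eulerProd (q ^ 2) * (∏' j : ℕ, (1 + ζ * q ^ (2 * j + 1))) ^ 2 := by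
  have hζ0 : ζ ≠ 0 := by rintro rfl; simp at hζ
  have hζ1 : ‖ζ‖ = 1 := by
    have : ‖ζ‖ ^ 2 = 1 := by rw [← norm_pow, hζ, norm_one]
    exact (pow_eq_one_iff_of_nonneg (norm_nonneg _) two_ne_zero).mp this
  have hq2 : ‖q ^ 2‖ < 1 := by rw [norm_pow]; exact pow_lt_one₀ (norm_nonneg _) hq two_ne_zero
  have hs : Summable fun m : ℤ => ‖ζ ^ m * q ^ (m ^ 2)‖ := by
    simpa [norm_mul, norm_zpow, hζ1] using summable_pow_mul_norm_zpow_sq hq0 hq 0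
  have h1 := tendsto_sum_gaussBinom hq2 0 hs
  have hm : Multipliable fun j : ℕ => 1 + ζ * q ^ (2 * j + 1) := by
    refine multipliable_one_add_of_summable ?_
    simp only [norm_mul, hζ1, one_mul, norm_pow]
    have := (summable_geometric_of_lt_one (norm_nonneg _) hq2).mul_left ‖q‖
    refine this.congr fun j => ?_
    rw [norm_pow]; ring
  have h2 := hm.hasProd.tendsto_prod_nat.pow 2
  have h3 := tendsto_nhds_unique (h1.congr fun n => ?_) h2
  · rw [← h3]
    have := eulerProd_ne_zero hq2
    field_simp
  · rw [← sum_sign_gaussBinom hq0 hζ]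
    refine Finset.sum_congr rfl fun k _ => ?_
    congr 2
    rw [zpow_sub₀ hζ0, zpow_natCast, zpow_natCast, pow_add, div_eq_iff (pow_ne_zero _ hζ0),
      mul_assoc, ← pow_two, ← pow_mul, mul_comm n, pow_mul, hζ]
    simp

/-- Jacobi's formula for the cube of the Euler product. -/
theorem tsum_linear_zpow {w : ℂ} (hw0 : w ≠ 0) (hw : ‖w‖ < 1) :
    ∑' m : ℤ, (1 - (m : ℂ)) * ((-1) ^ m * w ^ (m * (m - 1))) = eulerProd (w ^ 2) ^ 3 := by
  have hq0 : w ^ 2 ≠ 0 := pow_ne_zero _ hw0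
  have hw2 : ‖w ^ 2‖ < 1 := by rw [norm_pow]; exact pow_lt_one₀ (norm_nonneg _) hw two_ne_zero
  have hs : Summable fun m : ℤ => ‖(1 - (m : ℂ)) * ((-1) ^ m * w ^ (m * (m - 1)))‖ := by
    have hpos : 0 < ‖w‖ := norm_pos_iff.mpr hw0
    have hT : 0 < -Real.log ‖w‖ / Real.pi :=
      div_pos (neg_pos.mpr (Real.log_neg hpos hw)) Real.pi_pos
    set T := -Real.log ‖w‖ / Real.pi with hTdef
    have hlog : Real.log ‖w‖ = -Real.pi * T := by
      rw [hTdef]; field_simp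
    -- The exponent `m² - m` is not a pure square: the parameter `T / 2` in the theta bound absorbs
    -- its linear part, and `|1 - m| ≤ 1 + |m|` accounts for the two bounds.
    refine Summable.of_nonneg_of_le (fun _ => norm_nonneg _) (fun m => ?_)
      ((summable_pow_mul_jacobiTheta₂_term_bound (T / 2) hT 0).add
        (summable_pow_mul_jacobiTheta₂_term_bound (T / 2) hT 1))
    rw [← add_mul, norm_mul, norm_mul, norm_zpow, norm_neg, norm_one, one_zpow, one_mul, norm_zpow,
      pow_zero, pow_one]
    gcongr
    · refine (norm_sub_le _ _).trans ?_
      rw [norm_one, Complex.norm_intCast, Int.cast_abs]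
    · rw [← Real.rpow_intCast, Real.rpow_def_of_pos hpos, hlog]
      refine Real.exp_le_exp.mpr ?_
      have h1 : (m : ℝ) ≤ |m| := by exact_mod_cast le_abs_self m
      push_cast at h1 ⊢
      nlinarith [mul_nonneg (mul_pos Real.pi_pos hT).le (sub_nonneg.mpr h1)]
  have h1 := tendsto_sum_gaussBinom hw2 1 hs
  have h2 := (tendsto_qPoch hw2).pow 2
  have h3 := tendsto_nhds_unique (h1.congr fun n => ?_) h2
  · have := eulerProd_ne_zero hw2
    rw [pow_succ, ← h3]
    field_simp
  · rw [← sum_linear_gaussBinom hq0]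
    refine Finset.sum_congr rfl fun k _ => ?_
    have e1 : (-1 : ℂ) ^ ((k : ℤ) - n) = (-1) ^ (k + n) := by
      rw [zpow_sub₀ (by norm_num), zpow_natCast, zpow_natCast, pow_add,
        div_eq_iff (pow_ne_zero _ (by norm_num)), mul_assoc, ← pow_two, ← pow_mul, mul_comm n,
        pow_mul]
      simp
    have e2 : w ^ (((k : ℤ) - n) * (k - n - 1)) = (w ^ 2) ^ (k.choose 2) *
        (w ^ 2) ^ (-((n * k : ℕ) : ℤ)) * (w ^ 2) ^ ((n + 1).choose 2) := by
      rw [← zpow_natCast w 2, ← zpow_mul, ← zpow_natCast, ← zpow_natCast, ← zpow_mul, ← zpow_mul,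
        ← zpow_add₀ hw0, ← zpow_add₀ hw0]
      congr 1
      have h5 := two_mul_choose_two k
      have h6 := two_mul_choose_two (n + 1)
      push_cast at h5 h6 ⊢
      rw [h5, h6]
      ring
    rw [e1, e2]
    push_cast
    ring

end EulerProduct

/-! ### Theta series with polynomial weights and their derivatives -/

section ThetaSeries

open Filter Topology Derivative Complex
open UpperHalfPlane hiding I
open scoped Manifold Real

theorem normalizedDeriv_eq_of_hasDerivAt {F : ℍ → ℂ} {G : ℂ → ℂ} {d : ℂ} {τ : ℍ}
    (h : HasDerivAt G d τ) (hFG : ∀ σ : ℍ, F σ = G σ) :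
    normalizedDerivOfComplex F τ = (2 * π * I)⁻¹ * d := by
  rw [normalizedDerivOfComplex]
  congr 1
  refine (h.congr_of_eventuallyEq ?_).deriv
  filter_upwards [isOpen_upperHalfPlaneSet.mem_nhds τ.im_pos] with z hz
  rw [Function.comp_apply, ofComplex_apply_of_im_pos hz, hFG]

theorem mdifferentiable_of_forall_differentiableAt {F : ℍ → ℂ} {G : ℂ → ℂ}
    (h : ∀ τ : ℍ, DifferentiableAt ℂ G τ) (hFG : ∀ σ : ℍ, F σ = G σ) : MDiff F := by
  rw [UpperHalfPlane.mdifferentiable_iff]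
  intro z hz
  refine ((h ⟨z, hz⟩).congr_of_eventuallyEq ?_).differentiableWithinAt
  filter_upwards [isOpen_upperHalfPlaneSet.mem_nhds hz] with w hw
  rw [Function.comp_apply, ofComplex_apply_of_im_pos hw, hFG]

/-- The function `∑ b, c b * exp (π i r b ^ 2 τ)`. -/
def thetaSeries (r : ℕ) (c : ℤ → ℂ) (τ : ℍ) : ℂ :=
  ∑' b : ℤ, c b * cexp (π * I * r * b ^ 2 * τ)

theorem norm_thetaSeries_term_le {r : ℕ} (hr : 0 < r) {c : ℤ → ℂ} {j : ℕ}
    (hc : ∀ b : ℤ, ‖c b‖ ≤ (|b| ^ j : ℝ)) {T : ℝ} (hT : 0 ≤ T) {z : ℂ}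
    (hz : T ≤ z.im) (b : ℤ) :
    ‖c b * cexp (π * I * r * b ^ 2 * z)‖ ≤
      (|b| ^ j : ℝ) * Real.exp (-π * (T * b ^ 2 - 2 * 0 * |b|)) := by
  rw [norm_mul, Complex.norm_exp]
  gcongr
  · exact hc b
  · have h1 : (π * I * r * b ^ 2 * z).re = -(π * (r * b ^ 2 * z.im)) := by
      have : (π * I * r * b ^ 2 * z) = ((π * r * b ^ 2 : ℝ) : ℂ) * (I * z) := by push_cast; ring
      rw [this, Complex.re_ofReal_mul]
      simp
      ring
    rw [h1]
    have hr1 : (1 : ℝ) ≤ r := by exact_mod_cast hr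
    have h2 : T * (b : ℝ) ^ 2 ≤ r * b ^ 2 * z.im := by
      have : (b : ℝ) ^ 2 * T ≤ (b : ℝ) ^ 2 * (r * z.im) := by
        gcongr
        nlinarith
      linarith
    have := mul_le_mul_of_nonneg_left h2 Real.pi_pos.le
    linarith

theorem summable_norm_thetaSeries_term {r : ℕ} (hr : 0 < r) {c : ℤ → ℂ} {j : ℕ}
    (hc : ∀ b : ℤ, ‖c b‖ ≤ (|b| ^ j : ℝ)) (τ : ℍ) :
    Summable fun b : ℤ => ‖c b * cexp (π * I * r * b ^ 2 * τ)‖ := by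
  refine Summable.of_nonneg_of_le (fun _ => norm_nonneg _) (fun b => ?_)
    (summable_pow_mul_jacobiTheta₂_term_bound 0 τ.im_pos j)
  exact norm_thetaSeries_term_le hr hc τ.im_pos.le le_rfl b

/-- Termwise differentiation, justified by a uniform majorant on the half plane `Im z > Im τ / 2`.
-/
theorem hasDerivAt_thetaSeries {r : ℕ} (hr : 0 < r) {c : ℤ → ℂ} {j : ℕ}
    (hc : ∀ b : ℤ, ‖c b‖ ≤ (|b| ^ j : ℝ)) (τ : ℍ) :
    HasDerivAt (fun z : ℂ => ∑' b : ℤ, c b * cexp (π * I * r * b ^ 2 * z))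
      (2 * π * I * (r / 2) * thetaSeries r (fun b => c b * b ^ 2) τ) τ := by
  set T := τ.im / 2 with hT
  have hT0 : 0 < T := half_pos τ.im_pos
  set U : Set ℂ := {z | T < z.im} with hU
  have hUo : IsOpen U := isOpen_lt continuous_const Complex.continuous_im
  have hτ : (τ : ℂ) ∈ U := by
    have : T < τ.im := half_lt_self τ.im_pos
    exact this
  have hsum := summable_pow_mul_jacobiTheta₂_term_bound 0 hT0 j
  have hdiff : ∀ b : ℤ, DifferentiableOn ℂ (fun z : ℂ => c b * cexp (π * I * r * b ^ 2 * z)) U :=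
    fun b => by fun_prop
  have hle : ∀ (b : ℤ) (w : ℂ), w ∈ U → ‖c b * cexp (π * I * r * b ^ 2 * w)‖ ≤ _ :=
    fun b w hw => norm_thetaSeries_term_le hr hc hT0.le (le_of_lt hw) b
  have h1 := hasSum_deriv_of_summable_norm hsum hdiff hUo hle hτ
  have h2 := (differentiableOn_tsum_of_summable_norm hsum hdiff hUo hle).differentiableAt
    (hUo.mem_nhds hτ)
  convert! h2.hasDerivAt using 1
  rw [← h1.tsum_eq, thetaSeries, ← tsum_mul_left]
  refine tsum_congr fun b => ?_
  have : HasDerivAt (fun z : ℂ => c b * cexp (π * I * r * b ^ 2 * z))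
      (c b * (cexp (π * I * r * b ^ 2 * τ) * (π * I * r * b ^ 2 * 1))) τ :=
    (((hasDerivAt_id' (τ : ℂ)).const_mul (π * I * r * b ^ 2 : ℂ)).cexp).const_mul (c b)
  rw [this.deriv]
  ring

theorem mdifferentiable_thetaSeries {r : ℕ} (hr : 0 < r) {c : ℤ → ℂ} {j : ℕ}
    (hc : ∀ b : ℤ, ‖c b‖ ≤ (|b| ^ j : ℝ)) : MDiff (thetaSeries r c) :=
  mdifferentiable_of_forall_differentiableAt
    (fun τ => (hasDerivAt_thetaSeries hr hc τ).differentiableAt) fun _ => rfl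

theorem normalizedDeriv_thetaSeries {r : ℕ} (hr : 0 < r) {c : ℤ → ℂ} {j : ℕ}
    (hc : ∀ b : ℤ, ‖c b‖ ≤ (|b| ^ j : ℝ)) :
    normalizedDerivOfComplex (thetaSeries r c) =
      (r / 2 : ℂ) • thetaSeries r (fun b => c b * b ^ 2) := by
  funext τ
  rw [normalizedDeriv_eq_of_hasDerivAt (F := thetaSeries r c) (hasDerivAt_thetaSeries hr hc τ)
    fun _ => rfl]
  have : (2 * π * I : ℂ) ≠ 0 := Complex.two_pi_I_ne_zero
  simp only [Pi.smul_apply, smul_eq_mul]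
  field_simp

/-- The coefficients `i ^ b * b ^ j`, on the integers of a given parity. -/
def momentCoeff (ε : Bool) (j : ℕ) (b : ℤ) : ℂ :=
  if decide (Odd b) = ε then I ^ b * (b : ℂ) ^ j else 0

theorem norm_momentCoeff_le (ε : Bool) (j : ℕ) (b : ℤ) : ‖momentCoeff ε j b‖ ≤ (|b| ^ j : ℝ) := by
  rw [momentCoeff]
  split_ifs
  · rw [norm_mul, norm_zpow, norm_I, one_zpow, one_mul, norm_pow, Complex.norm_intCast, Int.cast_abs]
  · rw [norm_zero]; positivity

/-- The function `∑ b, i ^ b * b ^ j * exp (π i b ^ 2 τ)`, where `b` runs over the integers of a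
given parity. -/
def thetaMoment (ε : Bool) (j : ℕ) : ℍ → ℂ := thetaSeries 1 (momentCoeff ε j)

theorem mdifferentiable_thetaMoment (ε : Bool) (j : ℕ) : MDiff (thetaMoment ε j) :=
  mdifferentiable_thetaSeries one_pos (norm_momentCoeff_le ε j)

/-- The heat equation: `exp (π i b² τ)` is an eigenfunction of the normalized derivative with
eigenvalue `b² / 2`. -/
theorem thetaMoment_add_two (ε : Bool) (j : ℕ) :
    thetaMoment ε (j + 2) = (2 : ℂ) • normalizedDerivOfComplex (thetaMoment ε j) := by
  rw [thetaMoment, thetaMoment, normalizedDeriv_thetaSeries one_pos (norm_momentCoeff_le ε j),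
    smul_smul]
  have : (fun b : ℤ => momentCoeff ε j b * (b : ℂ) ^ 2) = momentCoeff ε (j + 2) := by
    funext b
    simp only [momentCoeff]
    split_ifs
    · ring
    · simp
  rw [this]
  simp

theorem I_zpow_neg_of_even {b : ℤ} (hb : Even b) : I ^ (-b) = I ^ b := by
  obtain ⟨m, rfl⟩ := hb
  rw [← two_mul, ← mul_neg, zpow_mul, zpow_mul]
  norm_cast
  rw [I_sq]
  rw [← inv_zpow', inv_neg, inv_one]

theorem I_zpow_neg_of_odd {b : ℤ} (hb : Odd b) : I ^ (-b) = -I ^ b := by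
  obtain ⟨m, rfl⟩ := hb
  have h : I ^ (-(2 * m + 1)) = I ^ (-(2 * m)) * I ^ (-1 : ℤ) := by
    rw [← zpow_add₀ I_ne_zero]; congr 1; ring
  rw [h, I_zpow_neg_of_even (even_two_mul m), zpow_add₀ I_ne_zero]
  simp

theorem momentCoeff_neg (ε : Bool) (j : ℕ) (b : ℤ) :
    momentCoeff ε j (-b) = (-1) ^ (j + ε.toNat) * momentCoeff ε j b := by
  rw [momentCoeff, momentCoeff]
  simp only [odd_neg]
  split_ifs with h
  · cases ε
    · have hb : Even b := by simpa using h
      rw [I_zpow_neg_of_even hb]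
      push_cast
      rw [neg_pow]
      simp
      ring
    · have hb : Odd b := by simpa using h
      rw [I_zpow_neg_of_odd hb]
      push_cast
      rw [neg_pow]
      simp
      ring
  · simp

/-- The reflection `b ↦ -b` changes the sign of every term, because `i^(-b)` is `i^b` for even `b`
and `-i^b` for odd `b`. -/
theorem thetaMoment_eq_zero {ε : Bool} {j : ℕ} (h : Odd (j + ε.toNat)) : thetaMoment ε j = 0 := by
  funext τ
  have h1 : thetaMoment ε j τ = -thetaMoment ε j τ := by
    conv_lhs => rw [thetaMoment, thetaSeries, ← (Equiv.neg ℤ).tsum_eq]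
    rw [thetaMoment, thetaSeries, ← tsum_neg]
    refine tsum_congr fun b => ?_
    rw [Equiv.neg_apply, momentCoeff_neg, h.neg_one_pow]
    push_cast
    ring_nf
  simpa [self_eq_neg] using h1

end ThetaSeries

/-! ### Product formulas for the basic theta functions -/

section EtaQuotients

open Filter Topology Derivative Complex
open UpperHalfPlane hiding I
open scoped Manifold Real

/-- Multiplication by a positive integer on the upper half plane. -/
def scale (N : ℕ) [NeZero N] (τ : ℍ) : ℍ :=
  ⟨N * τ, by
    have : (0 : ℝ) < N := by exact_mod_cast Nat.pos_of_neZero N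
    simpa using mul_pos this τ.im_pos⟩

@[simp]
theorem coe_scale (N : ℕ) [NeZero N] (τ : ℍ) : (scale N τ : ℂ) = N * τ := rfl

@[simp]
theorem im_scale (N : ℕ) [NeZero N] (τ : ℍ) : (scale N τ).im = N * τ.im := by
  simp [← UpperHalfPlane.coe_im]

theorem hasDerivAt_comp_scale (N : ℕ) [NeZero N] {F : ℍ → ℂ} (hF : MDiff F) (τ : ℍ) :
    HasDerivAt (fun z : ℂ => (F ∘ ofComplex) (N * z))
      (N * deriv (F ∘ ofComplex) (scale N τ)) τ := by
  have h1 := (UpperHalfPlane.mdifferentiableAt_iff.mp (hF (scale N τ))).hasDerivAt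
  have h2 : HasDerivAt (fun z : ℂ => (N : ℂ) * z) (N * 1) (τ : ℂ) :=
    (hasDerivAt_id' (τ : ℂ)).const_mul _
  rw [coe_scale] at h1
  convert! h1.comp (τ : ℂ) h2 using 1
  rw [coe_scale]
  ring

theorem comp_scale_eq (N : ℕ) [NeZero N] (F : ℍ → ℂ) (σ : ℍ) :
    (F ∘ scale N) σ = (fun z : ℂ => (F ∘ ofComplex) (N * z)) σ := by
  rw [Function.comp_apply]
  simp only [Function.comp_apply]
  rw [← coe_scale, ofComplex_apply]

theorem mdifferentiable_comp_scale (N : ℕ) [NeZero N] {F : ℍ → ℂ} (hF : MDiff F) :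
    MDiff (F ∘ scale N) :=
  mdifferentiable_of_forall_differentiableAt
    (fun τ => (hasDerivAt_comp_scale N hF τ).differentiableAt) (comp_scale_eq N F)

theorem normalizedDeriv_comp_scale (N : ℕ) [NeZero N] {F : ℍ → ℂ} (hF : MDiff F) :
    normalizedDerivOfComplex (F ∘ scale N) = (N : ℂ) • (normalizedDerivOfComplex F ∘ scale N) := by
  funext τ
  rw [normalizedDeriv_eq_of_hasDerivAt (hasDerivAt_comp_scale N hF τ) (comp_scale_eq N F)]
  simp only [Pi.smul_apply, Function.comp_apply, normalizedDerivOfComplex, smul_eq_mul]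
  ring

/-- The function `η (N τ)`. -/
def etaScale (N : ℕ) [NeZero N] (τ : ℍ) : ℂ := ModularForm.eta (scale N τ)

theorem etaScale_ne_zero (N : ℕ) [NeZero N] (τ : ℍ) : etaScale N τ ≠ 0 :=
  ModularForm.eta_ne_zero (scale N τ).im_pos

theorem differentiableAt_eta (τ : ℍ) : DifferentiableAt ℂ ModularForm.eta τ :=
  ModularForm.differentiableAt_eta_of_mem_upperHalfPlaneSet τ.im_pos

theorem mdifferentiable_etaScale (N : ℕ) [NeZero N] : MDiff (etaScale N) :=
  mdifferentiable_comp_scale (F := fun τ => ModularForm.eta τ) N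
    (mdifferentiable_of_forall_differentiableAt differentiableAt_eta fun _ => rfl)

/-- The function `E₂ (N τ)`. -/
def E2Scale (N : ℕ) [NeZero N] : ℍ → ℂ := EisensteinSeries.E2 ∘ scale N

/-- The logarithmic derivative of `η` is `E₂ / 24`; the chain rule supplies the factor `N`. -/
theorem normalizedDeriv_etaScale (N : ℕ) [NeZero N] :
    normalizedDerivOfComplex (etaScale N) = (N / 24 : ℂ) • (E2Scale N * etaScale N) := by
  have h0 := mdifferentiable_of_forall_differentiableAt (F := fun τ : ℍ => ModularForm.eta τ)
    differentiableAt_eta fun _ => rfl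
  have h1 := normalizedDeriv_comp_scale N h0
  have h2 : (fun τ : ℍ => ModularForm.eta τ) ∘ scale N = etaScale N := rfl
  rw [h2] at h1
  rw [h1]
  funext τ
  simp only [Pi.smul_apply, Function.comp_apply, smul_eq_mul, Pi.mul_apply, E2Scale]
  rw [normalizedDeriv_eq_of_hasDerivAt (differentiableAt_eta (scale N τ)).hasDerivAt fun _ => rfl]
  have h3 := ModularForm.logDeriv_eta_eq_E2 (scale N τ)
  rw [logDeriv_apply, div_eq_iff (ModularForm.eta_ne_zero (scale N τ).im_pos)] at h3
  rw [h3, etaScale]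
  have : (2 * π * I : ℂ) ≠ 0 := Complex.two_pi_I_ne_zero
  have := Complex.ofReal_ne_zero.mpr Real.pi_ne_zero
  have := I_ne_zero
  field_simp
  ring

/-- The variable `exp (2 π i τ)`. -/
def qVar (τ : ℍ) : ℂ := cexp (2 * π * I * τ)

theorem qVar_ne_zero (τ : ℍ) : qVar τ ≠ 0 := Complex.exp_ne_zero _

theorem norm_qVar_lt_one (τ : ℍ) : ‖qVar τ‖ < 1 := UpperHalfPlane.norm_exp_two_pi_I_lt_one τ

theorem qVar_scale (N : ℕ) [NeZero N] (τ : ℍ) : qVar (scale N τ) = qVar τ ^ N := by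
  rw [qVar, qVar, ← Complex.exp_nat_mul, coe_scale]
  ring_nf

theorem etaScale_eq (N : ℕ) [NeZero N] (τ : ℍ) :
    etaScale N τ = cexp (2 * π * I * (N * τ) / 24) * eulerProd (qVar τ ^ N) := by
  rw [etaScale, ModularForm.eta, ← qVar_scale]
  simp only [ModularForm.eta_q_eq_pow]
  rw [Function.Periodic.qParam, coe_scale]
  push_cast
  rfl

theorem multipliable_one_add_odd {q ζ : ℂ} (hq : ‖q‖ < 1) (hζ : ‖ζ‖ = 1) :
    Multipliable fun j : ℕ => 1 + ζ * q ^ (2 * j + 1) := by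
  have hq2 : ‖q ^ 2‖ < 1 := by rw [norm_pow]; exact pow_lt_one₀ (norm_nonneg _) hq two_ne_zero
  refine multipliable_one_add_of_summable ?_
  simp only [norm_mul, hζ, one_mul, norm_pow]
  have := (summable_geometric_of_lt_one (norm_nonneg _) hq2).mul_left ‖q‖
  refine this.congr fun j => ?_
  rw [norm_pow]; ring

theorem eulerProd_eq_mul {q : ℂ} (hq : ‖q‖ < 1) :
    eulerProd q = (∏' j : ℕ, (1 + (-1) * q ^ (2 * j + 1))) * eulerProd (q ^ 2) := by
  have hq2 : ‖q ^ 2‖ < 1 := by rw [norm_pow]; exact pow_lt_one₀ (norm_nonneg _) hq two_ne_zero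
  set f : ℕ → ℂ := fun n => 1 - q ^ (n + 1) with hf
  have e1 : (fun j : ℕ => 1 + (-1) * q ^ (2 * j + 1)) = fun j => f (2 * j) := by
    funext j; rw [hf]; ring
  have e2 : (fun j : ℕ => 1 - (q ^ 2) ^ (j + 1)) = fun j => f (2 * j + 1) := by
    funext j; simp only [hf]; rw [← pow_mul]; ring
  have h1 := multipliable_one_add_odd hq (ζ := -1) (by simp)
  have h2 := ModularForm.multipliable_one_sub_pow hq2
  rw [e1] at h1 ⊢
  rw [e2] at h2
  rw [eulerProd, eulerProd, e2]
  exact (tprod_even_mul_odd h1 h2).symm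

theorem tprod_odd_mul {q : ℂ} (hq : ‖q‖ < 1) :
    (∏' j : ℕ, (1 + 1 * q ^ (2 * j + 1))) * ∏' j : ℕ, (1 + (-1) * q ^ (2 * j + 1)) =
      ∏' j : ℕ, (1 + (-1) * (q ^ 2) ^ (2 * j + 1)) := by
  rw [← (multipliable_one_add_odd hq norm_one).tprod_mul
    (multipliable_one_add_odd hq (by simp))]
  refine tprod_congr fun j => ?_
  ring

theorem norm_sign_le (b : ℤ) : ‖(-1 : ℂ) ^ b‖ ≤ (|b| ^ 0 : ℝ) := by
  rw [norm_zpow]; simp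

theorem thetaSeries_two_sign (τ : ℍ) {ζ : ℂ} (hζ : ζ ^ 2 = 1) : thetaSeries 2 (fun b => ζ ^ b) τ =
    eulerProd (qVar τ ^ 2) * (∏' j : ℕ, (1 + ζ * qVar τ ^ (2 * j + 1))) ^ 2 := by
  rw [← tsum_sign_zpow_sq (qVar_ne_zero τ) (norm_qVar_lt_one τ) hζ, thetaSeries]
  refine tsum_congr fun b => ?_
  rw [qVar, ← Complex.exp_int_mul]
  push_cast
  ring_nf

/-- Gauss's product formula for `∑ b, (-1) ^ b q ^ (b ^ 2)`. -/
theorem thetaSeries_two_neg_one : thetaSeries 2 (fun b => (-1) ^ b) * etaScale 2 =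
    etaScale 1 ^ 2 := by
  funext τ
  have hq := norm_qVar_lt_one τ
  simp only [Pi.mul_apply, Pi.pow_apply]
  rw [thetaSeries_two_sign τ (by norm_num), etaScale_eq, etaScale_eq, pow_one, eulerProd_eq_mul hq,
    mul_pow, mul_pow, ← Complex.exp_nat_mul]
  push_cast
  ring_nf

/-- For `b = 2m` one has `i^b = (-1)^m` and `b² / 2 = 2 m²`, so Gauss's product applies at `2τ`. -/
theorem thetaMoment_false_zero_eq :
    thetaMoment false 0 = thetaSeries 2 (fun b => (-1) ^ b) ∘ scale 2 := by
  funext τ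
  rw [thetaMoment, thetaSeries, Function.comp_apply, thetaSeries]
  have hinj : Function.Injective (fun m : ℤ => 2 * m) := fun a b h => by simpa using h
  rw [← hinj.tsum_eq]
  · refine tsum_congr fun m => ?_
    rw [momentCoeff, if_pos (by simp), zpow_mul, coe_scale]
    norm_cast
    rw [I_sq]
    push_cast
    ring_nf
  · intro b hb
    have : ¬ Odd b := by
      intro h
      simp [momentCoeff, h] at hb
    obtain ⟨m, rfl⟩ := (Int.not_odd_iff_even.mp this).two_dvd
    exact ⟨m, rfl⟩

theorem thetaMoment_false_zero_mul : thetaMoment false 0 * etaScale 4 = etaScale 2 ^ 2 := by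
  have h := thetaSeries_two_neg_one
  funext τ
  have h1 := congrFun h (scale 2 τ)
  rw [thetaMoment_false_zero_eq]
  simp only [Pi.mul_apply, Pi.pow_apply, Function.comp_apply] at h1 ⊢
  have e1 : etaScale 2 (scale 2 τ) = etaScale 4 τ := by
    rw [etaScale, etaScale]; congr 1; simp; ring
  have e2 : etaScale 1 (scale 2 τ) = etaScale 2 τ := by
    rw [etaScale, etaScale]; congr 1; simp
  rw [← e1, ← e2, h1]

/-- Landen's relation `θ₃(q) θ₄(q) = θ₄(q²)²`, read off the products from `(1 + q^e)(1 - q^e) = 1 -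
q^(2e)`. -/
theorem thetaSeries_two_one_mul :
    thetaSeries 2 (fun b => 1 ^ b) * thetaSeries 2 (fun b => (-1) ^ b) = thetaMoment false 0 ^ 2 := by
  funext τ
  have hq := norm_qVar_lt_one τ
  have hq2 : ‖qVar τ ^ 2‖ < 1 := by
    rw [norm_pow]; exact pow_lt_one₀ (norm_nonneg _) hq two_ne_zero
  rw [thetaMoment_false_zero_eq]
  simp only [Pi.mul_apply, Pi.pow_apply, Function.comp_apply]
  rw [thetaSeries_two_sign τ (by norm_num), thetaSeries_two_sign τ (by norm_num),
    thetaSeries_two_sign (scale 2 τ) (by norm_num), qVar_scale, ← tprod_odd_mul hq,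
    eulerProd_eq_mul hq2, ← tprod_odd_mul hq]
  ring

/-- This is Jacobi's cube formula at `w = q²`, with `b = 2m - 1`. The weight there is `1 - m`;
subtracting the zeroth moment, which vanishes by parity, replaces `2m - 1` by `2(m - 1)`. -/
theorem thetaMoment_true_one : thetaMoment true 1 = (2 * I) • etaScale 4 ^ 3 := by
  funext τ
  have hinj : Function.Injective (fun m : ℤ => 2 * m - 1) := fun a b h => by
    simp only at h; omega
  have hre (j : ℕ) : thetaMoment true j τ = ∑' m : ℤ, momentCoeff true j (2 * m - 1) *
      cexp (π * I * (1 : ℕ) * ((2 * m - 1 : ℤ) : ℂ) ^ 2 * τ) := by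
    rw [thetaMoment, thetaSeries, ← hinj.tsum_eq]
    intro b hb
    have : Odd b := by
      by_contra h
      simp [momentCoeff, h] at hb
    obtain ⟨m, rfl⟩ := this
    exact ⟨m + 1, by simp only; ring⟩
  have hodd (m : ℤ) : Odd (2 * m - 1) := ⟨m - 1, by ring⟩
  have hI (m : ℤ) : I ^ (2 * m - 1) = -I * (-1) ^ m := by
    rw [zpow_sub₀ I_ne_zero, zpow_mul]
    norm_cast
    rw [I_sq]
    push_cast
    simp [div_eq_mul_inv]
    ring
  set w := qVar τ ^ 2 with hw
  have hw1 : ‖w‖ < 1 := by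
    rw [hw, norm_pow]; exact pow_lt_one₀ (norm_nonneg _) (norm_qVar_lt_one τ) two_ne_zero
  have hw0 : w ≠ 0 := pow_ne_zero _ (qVar_ne_zero τ)
  have h0 : thetaMoment true 0 τ = 0 := by
    rw [thetaMoment_eq_zero (by decide)]; rfl
  have hsum (j : ℕ) : Summable fun m : ℤ => momentCoeff true j (2 * m - 1) *
      cexp (π * I * (1 : ℕ) * ((2 * m - 1 : ℤ) : ℂ) ^ 2 * τ) :=
    ((summable_norm_thetaSeries_term one_pos (norm_momentCoeff_le true j) τ).of_norm).comp_injective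
      hinj
  have h1 : thetaMoment true 1 τ = thetaMoment true 0 τ + 2 * I * cexp (π * I * τ) *
      ∑' m : ℤ, (1 - (m : ℂ)) * ((-1) ^ m * w ^ (m * (m - 1))) := by
    rw [← tsum_mul_left, ← sub_eq_iff_eq_add', hre, hre, ← (hsum 1).tsum_sub (hsum 0)]
    refine tsum_congr fun m => ?_
    have hexp : cexp (π * I * (1 : ℕ) * ((2 * m - 1 : ℤ) : ℂ) ^ 2 * τ) =
        cexp (π * I * τ) * w ^ (m * (m - 1)) := by
      rw [hw, qVar, ← Complex.exp_nat_mul, ← Complex.exp_int_mul, ← Complex.exp_add]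
      push_cast
      ring_nf
    rw [hexp, momentCoeff, momentCoeff, if_pos (by simp [hodd]), if_pos (by simp [hodd]), hI]
    push_cast
    ring
  rw [h1, h0, tsum_linear_zpow hw0 hw1]
  simp only [Pi.smul_apply, Pi.pow_apply, smul_eq_mul]
  rw [etaScale_eq, mul_pow, ← Complex.exp_nat_mul, hw, ← pow_mul]
  push_cast
  ring_nf

end EtaQuotients

/-! ### The eta quotient `η(4τ)^8 / η(2τ)^4` as an Eisenstein series of weight two -/

section EtaQuotient

open Filter Topology Derivative Complex
open UpperHalfPlane hiding I
open scoped Manifold Real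

theorem mdifferentiable_thetaSeries_sign : MDiff (thetaSeries 2 (fun b => (-1) ^ b)) :=
  mdifferentiable_thetaSeries two_pos norm_sign_le

theorem norm_one_zpow_le (b : ℤ) : ‖(1 : ℂ) ^ b‖ ≤ (|b| ^ 0 : ℝ) := by simp

theorem mdifferentiable_thetaSeries_one : MDiff (thetaSeries 2 (fun b => 1 ^ b)) :=
  mdifferentiable_thetaSeries two_pos norm_one_zpow_le

theorem normalizedDeriv_etaScale_sq (N : ℕ) [NeZero N] (τ : ℍ) :
    normalizedDerivOfComplex (etaScale N ^ 2) τ =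
      N / 12 * E2Scale N τ * etaScale N τ ^ 2 := by
  rw [normalizedDerivOfComplex_pow _ _ (mdifferentiable_etaScale N), normalizedDeriv_etaScale]
  simp
  ring

/-- The logarithmic derivative of `η(Mτ)² / η(Nτ)`, obtained by the product rule and cancelling the
nonvanishing `η(Nτ)`. -/
theorem normalizedDeriv_of_mul_eq_sq {f : ℍ → ℂ} (hf : MDiff f) {M N : ℕ} [NeZero M] [NeZero N]
    (h : f * etaScale N = etaScale M ^ 2) :
    normalizedDerivOfComplex f = ((M / 12 : ℂ) • E2Scale M - (N / 24 : ℂ) • E2Scale N) * f := by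
  have h1 := congrArg normalizedDerivOfComplex h
  rw [normalizedDerivOfComplex_mul _ _ hf (mdifferentiable_etaScale N)] at h1
  funext τ
  have h2 := congrFun h1 τ
  have h3 := congrFun h τ
  rw [normalizedDeriv_etaScale_sq, normalizedDeriv_etaScale] at h2
  simp only [Pi.add_apply, Pi.mul_apply, Pi.smul_apply, smul_eq_mul, Pi.pow_apply,
    Pi.sub_apply] at h2 h3 ⊢
  have h4 := etaScale_ne_zero N τ
  refine mul_right_cancel₀ h4 ?_
  rw [← h3] at h2
  linear_combination h2

theorem normalizedDeriv_thetaMoment_false_zero :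
    normalizedDerivOfComplex (thetaMoment false 0) =
      ((1 / 6 : ℂ) • (E2Scale 2 - E2Scale 4)) * thetaMoment false 0 := by
  rw [normalizedDeriv_of_mul_eq_sq (mdifferentiable_thetaMoment _ _) thetaMoment_false_zero_mul]
  congr 1
  funext τ
  simp
  ring

theorem normalizedDeriv_thetaMoment_true_one :
    normalizedDerivOfComplex (thetaMoment true 1) =
      ((1 / 2 : ℂ) • E2Scale 4) * thetaMoment true 1 := by
  have hη := mdifferentiable_etaScale 4
  rw [thetaMoment_true_one, normalizedDerivOfComplex_smul _ _ (hη.pow 3),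
    normalizedDerivOfComplex_pow _ _ hη, normalizedDeriv_etaScale]
  funext τ
  simp
  ring

/-- The Wronskian of the theta functions `∑ (-1) ^ b q ^ (b ^ 2)` and `∑ q ^ (b ^ 2)`. -/
theorem wronskian_thetaSeries :
    thetaSeries 2 (fun b => (-1) ^ b) * normalizedDerivOfComplex (thetaSeries 2 (fun b => 1 ^ b)) -
      thetaSeries 2 (fun b => 1 ^ b) *
        normalizedDerivOfComplex (thetaSeries 2 (fun b => (-1) ^ b)) = -thetaMoment true 1 ^ 2 := by
  rw [normalizedDeriv_thetaSeries two_pos norm_sign_le,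
    normalizedDeriv_thetaSeries two_pos norm_one_zpow_le]
  funext τ
  simp only [Pi.sub_apply, Pi.mul_apply, Pi.smul_apply, Pi.neg_apply, Pi.pow_apply, smul_eq_mul]
  set E : ℤ → ℂ := fun b => cexp (π * I * (1 : ℕ) * b ^ 2 * τ) with hE
  set E2 : ℤ → ℂ := fun b => cexp (π * I * (2 : ℕ) * b ^ 2 * τ) with hE2
  have hs (c : ℤ → ℂ) (j : ℕ) (hc : ∀ b, ‖c b‖ ≤ (|b| ^ j : ℝ)) :
    Summable fun b : ℤ => ‖c b * E2 b‖ := summable_norm_thetaSeries_term two_pos hc τ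
  have hsm (ε : Bool) (j : ℕ) : Summable fun b : ℤ => ‖momentCoeff ε j b * E b‖ :=
    summable_norm_thetaSeries_term one_pos (norm_momentCoeff_le ε j) τ
  have hmul {f g : ℤ → ℂ} (hf : Summable fun b => ‖f b‖) (hg : Summable fun b => ‖g b‖) :
      HasSum (fun z : ℤ × ℤ => f z.1 * g z.2) ((∑' b, f b) * ∑' b, g b) := by
    rw [tsum_mul_tsum_of_summable_norm hf hg]
    exact (summable_mul_of_summable_norm hf hg).hasSum
  have hc1 (b : ℤ) : ‖(1 : ℂ) ^ b * b ^ 2‖ ≤ (|b| ^ 2 : ℝ) := by simp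
  have hc2 (b : ℤ) : ‖(-1 : ℂ) ^ b * b ^ 2‖ ≤ (|b| ^ 2 : ℝ) := by simp
  have hW := (hmul (hs _ 2 hc1) (hs _ 0 norm_sign_le)).sub
    (hmul (hs _ 0 norm_one_zpow_le) (hs _ 2 hc2))
  -- The second factor is taken at the negated index so that, with indices `m + n` and `m - n`, the
  -- powers of `i` give `i^(2n) = (-1)^n`.
  have hR (ε : Bool) := hmul (hsm ε 1) ((hsm ε 1).comp_injective neg_injective)
  have hR' := (hR false).add (hR true)
  have hneg (ε : Bool) : ∑' b, (fun b => momentCoeff ε 1 b * E b) (-b) =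
      ∑' b, momentCoeff ε 1 b * E b := (Equiv.neg ℤ).tsum_eq (fun b => momentCoeff ε 1 b * E b)
  -- The image consists of the pairs of equal parity, which is why both parities were added. The
  -- exponents match by `(m+n)² + (m-n)² = 2(m² + n²)`, the weights by `(m+n)(m-n) = m² - n²`.
  have hinj : Function.Injective (fun z : ℤ × ℤ => (z.1 + z.2, z.1 - z.2)) := by
    rintro ⟨a, b⟩ ⟨c, d⟩ h
    simp only [Prod.mk.injEq] at h ⊢
    omega
  have hJ := (hinj.hasSum_iff ?_).mpr hR'
  · have h1 := hW.unique (hJ.neg.congr_fun ?_)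
    · have h0 : ∑' b, momentCoeff false 1 b * E b = 0 := by
        have := congrFun (thetaMoment_eq_zero (ε := false) (j := 1) (by decide)) τ
        exact this
      simp only [hneg, h0] at h1
      have h2 : thetaMoment true 1 τ = ∑' b, momentCoeff true 1 b * E b := rfl
      rw [h2]
      simp only [thetaSeries]
      push_cast at h1 ⊢
      linear_combination h1
    · rintro ⟨m, n⟩
      have hEE : E (m + n) * E (-(m - n)) = E2 m * E2 n := by
        simp only [hE, hE2]
        rw [← Complex.exp_add, ← Complex.exp_add]
        push_cast
        ring_nf
      have hII : I ^ (m + n) * I ^ (-(m - n)) = (-1) ^ n := by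
        rw [← zpow_add₀ I_ne_zero, show m + n + -(m - n) = 2 * n by ring, zpow_mul]
        norm_cast
        rw [I_sq]
        simp
      have hpar : Odd (-(m - n)) ↔ Odd (m + n) := by
        rw [odd_neg, Int.odd_sub, Int.odd_add]
      have key : (I ^ (m + n) * ((m + n : ℤ) : ℂ) ^ 1 * E (m + n)) *
          (I ^ (-(m - n)) * ((-(m - n) : ℤ) : ℂ) ^ 1 * E (-(m - n))) =
          (-1) ^ n * (E2 m * E2 n) * ((n : ℂ) ^ 2 - m ^ 2) := by
        rw [← hEE, ← hII]
        push_cast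
        ring
      simp only [Function.comp_apply, momentCoeff, hpar, one_zpow]
      by_cases h : Odd (m + n)
      · simp only [h, decide_true, Bool.true_eq_false, if_false, if_true, zero_mul, zero_add, key]
        ring
      · simp only [h, decide_false, Bool.false_eq_true, if_false, if_true, zero_mul, add_zero, key]
        ring
  · rintro ⟨p, r⟩ hpr
    have h : ¬ (Odd p ↔ Odd r) := by
      intro h
      refine hpr ⟨((p + r) / 2, (p - r) / 2), ?_⟩
      have h1 : Even (p + r) := by rw [Int.even_add, ← Int.not_odd_iff_even, ← Int.not_odd_iff_even, h]
      have h2 : Even (p - r) := by rw [Int.even_sub, ← Int.not_odd_iff_even, ← Int.not_odd_iff_even, h]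
      obtain ⟨x, hx⟩ := h1
      obtain ⟨y, hy⟩ := h2
      simp only [Prod.mk.injEq]
      omega
    simp only [momentCoeff, odd_neg]
    by_cases hp : Odd p <;> by_cases hr : Odd r <;> simp [hp, hr] at h ⊢

/-- The eta quotient `η (4 τ) ^ 8 / η (2 τ) ^ 4`. -/
def etaQuot (τ : ℍ) : ℂ := etaScale 4 τ ^ 8 / etaScale 2 τ ^ 4

/-- Dividing the Wronskian by the product of the two theta functions gives the difference of their
logarithmic derivatives, equal to four times the eta quotient. One logarithmic derivative comes from
Gauss's product, the other from that of the product `thetaMoment false 0 ^ 2`; both are combinations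
of `E₂(Nτ)`. -/
theorem etaQuot_eq : etaQuot =
    (1 / 24 : ℂ) • ((3 : ℂ) • E2Scale 2 - (2 : ℂ) • E2Scale 4 - E2Scale 1) := by
  have hA := normalizedDeriv_thetaMoment_false_zero
  have hA1 := normalizedDeriv_of_mul_eq_sq mdifferentiable_thetaSeries_sign thetaSeries_two_neg_one
  have hP := congrArg normalizedDerivOfComplex thetaSeries_two_one_mul
  rw [normalizedDerivOfComplex_mul _ _ mdifferentiable_thetaSeries_one
    mdifferentiable_thetaSeries_sign, normalizedDerivOfComplex_pow _ _
    (mdifferentiable_thetaMoment _ _), hA, hA1] at hP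
  have hW := wronskian_thetaSeries
  rw [hA1, thetaMoment_true_one] at hW
  funext τ
  have hP := congrFun hP τ
  have hW := congrFun hW τ
  have h0 := congrFun thetaMoment_false_zero_mul τ
  have hPA := congrFun thetaSeries_two_one_mul τ
  have h4 := etaScale_ne_zero 4 τ
  have h2 := etaScale_ne_zero 2 τ
  simp only [Pi.add_apply, Pi.mul_apply, Pi.smul_apply, smul_eq_mul, Pi.pow_apply, Pi.sub_apply,
    Pi.neg_apply, Pi.natCast_apply] at hP hW h0 hPA ⊢
  rw [etaQuot, div_eq_iff (pow_ne_zero _ h2), show etaScale 2 τ ^ 4 = (etaScale 2 τ ^ 2) ^ 2 by ring,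
    ← h0]
  set a := thetaMoment false 0 τ
  set x := thetaSeries 2 (fun b => 1 ^ b) τ
  set y := thetaSeries 2 (fun b => (-1) ^ b) τ
  have hI := I_sq
  push_cast at *
  have : 4 * etaScale 4 τ ^ 6 = a ^ 2 * (3 * E2Scale 2 τ - 2 * E2Scale 4 τ - E2Scale 1 τ) / 6 := by
    linear_combination -hW + hP + (4 * etaScale 4 τ ^ 6) * hI -
      ((1 : ℂ) / 6 * (E2Scale 1 τ - E2Scale 2 τ)) * hPA
  linear_combination etaScale 4 τ ^ 2 / 4 * this

end EtaQuotient

/-! ### Ramanujan's differential equations in level one -/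

section LevelOne

open Filter Topology Derivative Complex
open UpperHalfPlane hiding I
open scoped Manifold Real ModularForm

/-- `S` and `T` generate `SL(2, ℤ)`, which has a single class of cusps, so these conditions suffice.
-/
theorem exists_modularForm_levelOne {k : ℤ} {F : ℍ → ℂ} (hF : MDiff F)
    (hS : F ∣[k] ModularGroup.S = F) (hT : F ∣[k] ModularGroup.T = F)
    (hb : IsBoundedAtImInfty F) : ∃ f : ModularForm 𝒮ℒ k, ⇑f = F :=
  ⟨{ toFun := F
     slash_action_eq' := by
       rintro _ ⟨A, rfl⟩
       exact SlashInvariantForm.slash_action_generators_SL2Z hS hT A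
     holo' := hF
     bdd_at_cusps' := fun hc => by
       rw [OnePoint.isBoundedAt_iff_forall_SL2Z hc]
       intro γ _
       rw [SlashInvariantForm.slash_action_generators_SL2Z hS hT]
       exact hb }, rfl⟩

/-- Cauchy's estimate on discs of radius one; centres at height `max A 0 + 2` keep the discs in the
region where `F` is bounded. -/
theorem isBoundedAtImInfty_normalizedDeriv {F : ℍ → ℂ} (hF : MDiff F)
    (hb : IsBoundedAtImInfty F) : IsBoundedAtImInfty (normalizedDerivOfComplex F) := by
  rw [isBoundedAtImInfty_iff] at hb ⊢
  obtain ⟨M, A, h⟩ := hb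
  refine ⟨‖(2 * π * I : ℂ)⁻¹‖ * (M / 1), max A 0 + 2, fun z hz => ?_⟩
  rw [normalizedDerivOfComplex, norm_mul]
  have him {w : ℂ} (hw : ‖w - z‖ ≤ 1) : max A 0 + 1 ≤ w.im := by
    have h1 := (Complex.abs_im_le_norm (w - z)).trans hw
    rw [Complex.sub_im, abs_le] at h1
    have : (z : ℂ).im = z.im := rfl
    linarith [h1.1]
  have hpos {w : ℂ} (hw : ‖w - z‖ ≤ 1) : 0 < w.im := by
    linarith [him hw, le_max_right A 0]
  gcongr
  refine Complex.norm_deriv_le_of_forall_mem_sphere_norm_le one_pos ?_ fun w hw => ?_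
  · refine DifferentiableOn.diffContOnCl fun w hw => ?_
    rw [closure_ball _ one_ne_zero, mem_closedBall_iff_norm] at hw
    exact (UpperHalfPlane.mdifferentiableAt_iff.mp
      (hF ⟨w, hpos hw⟩)).differentiableWithinAt
  · have hw' : ‖w - z‖ ≤ 1 := (mem_sphere_iff_norm.mp hw).le
    rw [Function.comp_apply, ofComplex_apply_of_im_pos (hpos hw')]
    refine h _ ?_
    have : A ≤ w.im := by linarith [him hw', le_max_left A 0]
    exact this

theorem isBoundedAtImInfty_mul {F G : ℍ → ℂ} (hF : IsBoundedAtImInfty F)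
    (hG : IsBoundedAtImInfty G) : IsBoundedAtImInfty (F * G) := by
  have h := Asymptotics.IsBigO.mul hF hG
  simp only [Pi.one_apply, mul_one] at h
  exact h

theorem isBoundedAtImInfty_serreDerivative {k : ℂ} {F : ℍ → ℂ} (hF : MDiff F)
    (hb : IsBoundedAtImInfty F) : IsBoundedAtImInfty (serreDerivative k F) := by
  have h1 := isBoundedAtImInfty_normalizedDeriv hF hb
  have h2 : IsBoundedAtImInfty ((k * 12⁻¹) • (EisensteinSeries.E2 * F)) :=
    Asymptotics.IsBigO.const_smul_left
      (isBoundedAtImInfty_mul EisensteinSeries.isBoundedAtImInfty_E2 hb) _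
  have h3 : serreDerivative k F =
      normalizedDerivOfComplex F - (k * 12⁻¹) • (EisensteinSeries.E2 * F) := by
    funext z
    simp
    ring
  rw [h3]
  exact Asymptotics.IsBigO.sub h1 h2

/-- The derivative of a modular form of level one. -/
theorem exists_normalizedDeriv_modularForm {k : ℤ} (f : ModularForm 𝒮ℒ k) :
    ∃ g : ModularForm 𝒮ℒ (k + 2), normalizedDerivOfComplex f =
      (k * 12⁻¹ : ℂ) • (EisensteinSeries.E2 * ⇑f) + ⇑g := by
  have hf : MDiff (f : ℍ → ℂ) := f.holo'
  have hinv (γ : SL(2, ℤ)) : (f : ℍ → ℂ) ∣[k] γ = f :=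
    SlashInvariantForm.slash_action_eqn f _ ⟨γ, rfl⟩
  have hb : IsBoundedAtImInfty (f : ℍ → ℂ) := by
    have := ModularFormClass.bdd_at_infty_slash f 1
    simpa using this
  obtain ⟨g, hg⟩ := exists_modularForm_levelOne (serreDerivative_mdifferentiable k hf)
    (serreDerivative_slash_invariant hf (hinv ModularGroup.S))
    (serreDerivative_slash_invariant hf (hinv ModularGroup.T))
    (isBoundedAtImInfty_serreDerivative hf hb)
  refine ⟨g, ?_⟩
  rw [hg]
  funext z
  simp
  ring

open EisensteinSeries in
theorem E2_slash_S :
    E2 ∣[(2 : ℤ)] ModularGroup.S = fun z : ℍ => E2 z - 6 * I / π / z := by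
  rw [E2_slash_action]
  funext z
  simp only [Pi.sub_apply, Pi.smul_apply, smul_eq_mul]
  rw [D2_S, riemannZeta_two]
  have := Complex.ofReal_ne_zero.mpr Real.pi_ne_zero
  have := z.ne_zero
  field_simp

open EisensteinSeries in
theorem E2_slash_T : E2 ∣[(2 : ℤ)] ModularGroup.T = E2 := by
  rw [E2_slash_action, D2_T, smul_zero, sub_zero]

open EisensteinSeries in
/-- The derivative of the Eisenstein series `E₂`. -/
theorem exists_normalizedDeriv_E2 :
    ∃ g : ModularForm 𝒮ℒ 4, normalizedDerivOfComplex E2 = (12⁻¹ : ℂ) • (E2 * E2) + ⇑g := by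
  have hT := E2_slash_T
  have hS := E2_slash_S
  have hsq (γ : SL(2, ℤ)) : (E2 * E2) ∣[(4 : ℤ)] γ = (E2 ∣[(2 : ℤ)] γ) * (E2 ∣[(2 : ℤ)] γ) :=
    ModularForm.mul_slash_SL2 2 2 γ E2 E2
  -- The parameter is 1 although `E₂` has weight 2: the quadratic part of the anomaly of `E₂` under
  -- `S` changes the coefficient, and `D E₂ - E₂² / 12` is the combination that is modular of weight
  -- 4.
  have hdec : serreDerivative 1 E2 = normalizedDerivOfComplex E2 - (12⁻¹ : ℂ) • (E2 * E2) := by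
    funext z
    simp [mul_assoc]
  have hslash (γ : SL(2, ℤ)) : serreDerivative 1 E2 ∣[(4 : ℤ)] γ =
      (normalizedDerivOfComplex E2 ∣[(4 : ℤ)] γ) -
        (12⁻¹ : ℂ) • ((E2 ∣[(2 : ℤ)] γ) * (E2 ∣[(2 : ℤ)] γ)) := by
    rw [hdec, sub_eq_add_neg, SlashAction.add_slash, SlashAction.neg_slash,
      ModularForm.SL_smul_slash, hsq, sub_eq_add_neg]
  have hD (γ : SL(2, ℤ)) := normalizedDerivOfComplex_SL_slash (k := 2) E2_mdifferentiable (γ := γ)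
  have hSS : serreDerivative 1 E2 ∣[(4 : ℤ)] ModularGroup.S = serreDerivative 1 E2 := by
    have hDS := hD ModularGroup.S
    rw [hS] at hDS
    have hder : normalizedDerivOfComplex (fun z : ℍ => E2 z - 6 * I / π / z) =
        fun z : ℍ => normalizedDerivOfComplex E2 z + (2 * π * I)⁻¹ * (6 * I / π / z ^ 2) := by
      funext z
      have h1 := (UpperHalfPlane.mdifferentiableAt_iff.mp (E2_mdifferentiable z)).hasDerivAt
      have h2 := ((hasDerivAt_inv z.ne_zero).const_mul (6 * I / π : ℂ))
      rw [normalizedDeriv_eq_of_hasDerivAt (h1.sub h2) fun σ => by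
        simp [ofComplex_apply, div_eq_mul_inv]]
      rw [normalizedDerivOfComplex]
      ring
    rw [hder] at hDS
    rw [hslash, hS]
    funext z
    have hz := congrFun hDS z
    have h10 : (ModularGroup.S 1 0 : ℤ) = 1 := rfl
    simp only [Pi.sub_apply, Pi.smul_apply, Pi.mul_apply, smul_eq_mul, serreDerivative,
      ModularGroup.denom_S, h10] at hz ⊢
    have hpi := Complex.ofReal_ne_zero.mpr Real.pi_ne_zero
    have hz0 := z.ne_zero
    push_cast at hz
    have e1 : (2 * π * I : ℂ)⁻¹ = -I / (2 * π) := by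
      rw [mul_inv, inv_I]
      ring
    rw [e1] at hz
    linear_combination -hz
  have hTT : serreDerivative 1 E2 ∣[(4 : ℤ)] ModularGroup.T = serreDerivative 1 E2 := by
    have hDT := hD ModularGroup.T
    have h10 : (ModularGroup.T 1 0 : ℤ) = 0 := rfl
    rw [hT, h10] at hDT
    rw [hslash, hT, hdec]
    congr 1
    funext z
    have hz := congrFun hDT z
    simp only [Pi.sub_apply, Int.cast_zero, zero_div, mul_zero, zero_mul, sub_zero] at hz
    exact hz.symm
  obtain ⟨g, hg⟩ := exists_modularForm_levelOne
    (serreDerivative_mdifferentiable 1 E2_mdifferentiable) hSS hTT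
    (isBoundedAtImInfty_serreDerivative E2_mdifferentiable isBoundedAtImInfty_E2)
  refine ⟨g, ?_⟩
  rw [hg, hdec]
  abel

end LevelOne

/-! ### Rescaled level one forms as quasimodular forms for `Γ₀(4)` -/

section LevelFour

open Filter Topology Derivative Complex
open UpperHalfPlane hiding I
open scoped Manifold Real ModularForm

/-- The diagonal matrix with entries `N` and `1`. -/
def scaleGL (K : Type*) [Field K] [CharZero K] (N : ℕ) [NeZero N] : GL (Fin 2) K :=
  Matrix.GeneralLinearGroup.mkOfDetNeZero !![(N : K), 0; 0, 1] (by
    simpa [Matrix.det_fin_two] using NeZero.ne N)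

theorem coe_scaleGL (K : Type*) [Field K] [CharZero K] (N : ℕ) [NeZero N] :
    (scaleGL K N : Matrix (Fin 2) (Fin 2) K) = !![(N : K), 0; 0, 1] := rfl

theorem scaleGL_map (N : ℕ) [NeZero N] : (scaleGL ℚ N).map (Rat.castHom ℝ) = scaleGL ℝ N := by
  ext i j
  fin_cases i <;> fin_cases j <;> simp [coe_scaleGL]

theorem det_scaleGL (N : ℕ) [NeZero N] : (scaleGL ℝ N).det.val = N := by
  rw [Matrix.GeneralLinearGroup.val_det_apply, coe_scaleGL]
  simp [Matrix.det_fin_two]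

theorem det_scaleGL_pos (N : ℕ) [NeZero N] : 0 < (scaleGL ℝ N).det.val := by
  rw [det_scaleGL]
  exact_mod_cast Nat.pos_of_neZero N

theorem scaleGL_smul (N : ℕ) [NeZero N] (τ : ℍ) : scaleGL ℝ N • τ = scale N τ := by
  ext1
  rw [coe_smul_of_det_pos (det_scaleGL_pos N), coe_scale, num, denom]
  simp [coe_scaleGL]

theorem slash_scaleGL (N : ℕ) [NeZero N] (k : ℤ) (F : ℍ → ℂ) :
    F ∣[k] scaleGL ℝ N = ((N : ℂ) ^ (k - 1)) • (F ∘ scale N) := by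
  funext τ
  rw [ModularForm.slash_apply, scaleGL_smul, det_scaleGL, σ, if_pos (det_scaleGL_pos N), denom]
  simp [coe_scaleGL, mul_comm]

/-- Conjugation by `diag(N, 1)` multiplies the upper right entry by `N` and divides the lower left
one by `N`, so it stays integral. -/
theorem scaleGL_mul_mapGL {N : ℕ} [NeZero N] {γ : SL(2, ℤ)} (h : (N : ℤ) ∣ γ 1 0) :
    ∃ γ' : SL(2, ℤ), scaleGL ℝ N * Matrix.SpecialLinearGroup.mapGL ℝ γ =
      Matrix.SpecialLinearGroup.mapGL ℝ γ' * scaleGL ℝ N := by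
  obtain ⟨c, hc⟩ := h
  have hdet := γ.det_coe
  rw [Matrix.det_fin_two, hc] at hdet
  set γ' : SL(2, ℤ) := ⟨!![γ 0 0, N * γ 0 1; c, γ 1 1], by
    rw [Matrix.det_fin_two_of]; linear_combination hdet⟩ with hγ'
  have e00 : γ' 0 0 = γ 0 0 := rfl
  have e01 : γ' 0 1 = N * γ 0 1 := rfl
  have e10 : γ' 1 0 = c := rfl
  have e11 : γ' 1 1 = γ 1 1 := rfl
  have hc' : ((γ 1 0 : ℤ) : ℝ) = N * c := by rw [hc]; push_cast; rfl
  clear_value γ'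
  refine ⟨γ', ?_⟩
  ext i j
  fin_cases i <;> fin_cases j <;>
    simp [coe_scaleGL, Matrix.mul_apply, Fin.sum_univ_two, hc', mul_comm, e00, e01, e10, e11]

-- Level one cusps are the rational points and infinity, permuted by any rational matrix.
open OnePoint in
theorem isCusp_scaleGL_smul (N : ℕ) [NeZero N] {c : OnePoint ℝ} (hc : IsCusp c 𝒮ℒ) :
    IsCusp (scaleGL ℝ N • c) 𝒮ℒ := by
  rw [isCusp_SL2Z_iff] at hc ⊢
  obtain ⟨x, rfl⟩ := hc
  refine ⟨scaleGL ℚ N • x, ?_⟩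
  rw [← Rat.coe_castHom, OnePoint.map_smul, scaleGL_map]

/-- A function which satisfies the condition at all cusps and is invariant under `Γ₀(4)`. -/
structure IsSlashBounded (k : ℤ) (F : ℍ → ℂ) : Prop where
  slash_eq (γ : SL(2, ℤ)) (hγ : γ ∈ CongruenceSubgroup.Gamma0 4) :
    F ∣[k] Matrix.SpecialLinearGroup.mapGL ℝ γ = F
  bdd {c : OnePoint ℝ} (hc : IsCusp c 𝒮ℒ) : c.IsBoundedAt F k

/-- Holomorphy is not assumed, so that this also applies to `E2Star`. -/
theorem isSlashBounded_slash_scaleGL {k : ℤ} {F : ℍ → ℂ} (hinv : ∀ γ : SL(2, ℤ), F ∣[k] γ = F)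
    (hb : IsBoundedAtImInfty F) {N : ℕ} [NeZero N] (hN : N ∣ 4) :
    IsSlashBounded k (F ∣[k] scaleGL ℝ N) where
  slash_eq γ hγ := by
    rw [CongruenceSubgroup.Gamma0_mem] at hγ
    have h4 : (4 : ℤ) ∣ γ 1 0 := by
      exact_mod_cast (ZMod.intCast_zmod_eq_zero_iff_dvd _ 4).mp hγ
    obtain ⟨γ', h⟩ := scaleGL_mul_mapGL (N := N) ((by exact_mod_cast hN : (N : ℤ) ∣ 4).trans h4)
    rw [← SlashAction.slash_mul, h, SlashAction.slash_mul]
    congr 1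
    exact hinv γ'
  bdd {c} hc := by
    rw [← OnePoint.IsBoundedAt.smul_iff,
      OnePoint.isBoundedAt_iff_forall_SL2Z (isCusp_scaleGL_smul N hc)]
    intro γ _
    rw [hinv]
    exact hb

theorem IsSlashBounded.mem_quasimodularRing {k : ℤ} {F : ℍ → ℂ} (h : IsSlashBounded k F)
    (hF : MDiff F) : F ∈ quasimodularRing (CongruenceSubgroup.Gamma0 4) := by
  refine Algebra.subset_adjoin (Or.inl ⟨k, ⟨⟨F, ?_⟩, hF, ?_⟩, rfl⟩)
  · rintro _ ⟨γ, hγ, rfl⟩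
    exact h.slash_eq γ hγ
  · intro c hc
    refine h.bdd (hc.mono ?_)
    rintro _ ⟨γ, -, rfl⟩
    exact ⟨γ, rfl⟩

theorem IsSlashBounded.sub {k : ℤ} {F G : ℍ → ℂ} (hF : IsSlashBounded k F)
    (hG : IsSlashBounded k G) : IsSlashBounded k (F - G) where
  slash_eq γ hγ := by
    rw [sub_eq_add_neg, SlashAction.add_slash, SlashAction.neg_slash, hF.slash_eq γ hγ,
      hG.slash_eq γ hγ]
  bdd hc g hg := by
    rw [sub_eq_add_neg, SlashAction.add_slash, SlashAction.neg_slash, ← sub_eq_add_neg]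
    exact Asymptotics.IsBigO.sub (hF.bdd hc g hg) (hG.bdd hc g hg)

theorem modularForm_slash_eq {k : ℤ} (f : ModularForm 𝒮ℒ k) (γ : SL(2, ℤ)) :
    (f : ℍ → ℂ) ∣[k] γ = f :=
  SlashInvariantForm.slash_action_eqn f _ ⟨γ, rfl⟩

theorem modularForm_isBoundedAtImInfty {k : ℤ} (f : ModularForm 𝒮ℒ k) :
    IsBoundedAtImInfty (f : ℍ → ℂ) := by
  have := ModularFormClass.bdd_at_infty_slash f 1
  simpa using this

theorem modularForm_comp_scale_mem {k : ℤ} (f : ModularForm 𝒮ℒ k) {N : ℕ} [NeZero N] (hN : N ∣ 4) :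
    ⇑f ∘ scale N ∈ quasimodularRing (CongruenceSubgroup.Gamma0 4) := by
  have h := (isSlashBounded_slash_scaleGL (modularForm_slash_eq f)
    (modularForm_isBoundedAtImInfty f) hN).mem_quasimodularRing (MDifferentiable.slash f.holo' k _)
  rw [slash_scaleGL] at h
  have h0 : ((N : ℂ) ^ (k - 1)) ≠ 0 := zpow_ne_zero _ (Nat.cast_ne_zero.mpr (NeZero.ne N))
  have h1 := Subalgebra.smul_mem _ h ((N : ℂ) ^ (k - 1))⁻¹
  rwa [smul_smul, inv_mul_cancel₀ h0, one_smul] at h1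

/-- The nonholomorphic modular Eisenstein series of weight two. -/
def E2Star (τ : ℍ) : ℂ := EisensteinSeries.E2 τ - 3 / (π * τ.im)

/-- The term `3 / (π Im τ)` compensates the anomaly of `E₂` under `S`, by `Im (-1/z) = Im z / |z|²`
and `conj z = z - 2 i Im z`. -/
theorem E2Star_slash (γ : SL(2, ℤ)) : E2Star ∣[(2 : ℤ)] γ = E2Star := by
  refine SlashInvariantForm.slash_action_generators_SL2Z ?_ ?_ γ
  · funext z
    have h := congrFun E2_slash_S z
    rw [ModularForm.SL_slash_apply] at h ⊢
    rw [ModularGroup.denom_S] at h ⊢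
    rw [E2Star, E2Star, sub_mul, h]
    have him : (((ModularGroup.S • z).im : ℝ) : ℂ) = z.im / (z * (starRingEnd ℂ) z) := by
      rw [ModularGroup.im_smul_eq_div_normSq, ModularGroup.denom_S, Complex.mul_conj]
      push_cast
      rfl
    have hconj : (starRingEnd ℂ) (z : ℂ) = z - 2 * z.im * I := by
      apply Complex.ext
      · simp
      · simp
        ring
    have hy : (z.im : ℂ) ≠ 0 := Complex.ofReal_ne_zero.mpr z.im_pos.ne'
    have hz := z.ne_zero
    have hpi := Complex.ofReal_ne_zero.mpr Real.pi_ne_zero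
    have hc : (starRingEnd ℂ) (z : ℂ) ≠ 0 := by simpa using hz
    rw [him]
    have : 3 / (π * ((z.im : ℂ) / (z * (starRingEnd ℂ) (z : ℂ)))) * (z : ℂ) ^ (-2 : ℤ) =
        3 * (starRingEnd ℂ) (z : ℂ) / (π * z.im * z) := by
      have h2 : (z : ℂ) ^ (-2 : ℤ) = ((z : ℂ) ^ 2)⁻¹ := by rw [zpow_neg]; rfl
      rw [h2]
      field_simp
    rw [this, hconj]
    field_simp
    ring
  · funext z
    have h := congrFun E2_slash_T z
    rw [ModularForm.SL_slash_apply] at h ⊢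
    rw [E2Star, E2Star, sub_mul, h]
    have hd : denom (ModularGroup.T : GL (Fin 2) ℝ) z = 1 := by
      simp [denom]
    have him : (ModularGroup.T • z).im = z.im := by
      rw [modular_T_smul, vadd_im]
    rw [hd, him, one_zpow, mul_one]

theorem E2Star_bounded : IsBoundedAtImInfty E2Star := by
  refine Asymptotics.IsBigO.sub EisensteinSeries.isBoundedAtImInfty_E2 ?_
  refine isBoundedAtImInfty_iff.mpr ⟨3 / π, 1, fun z hz => ?_⟩
  have : (3 / (π * z.im) : ℂ) = ((3 / (π * z.im) : ℝ) : ℂ) := by push_cast; rfl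
  rw [this, Complex.norm_real, Real.norm_of_nonneg
    (div_nonneg (by norm_num) (mul_nonneg Real.pi_pos.le z.im_pos.le))]
  have := Real.pi_pos
  gcongr
  nlinarith

/-- In `N E₂*(Nτ) - E₂*(τ)` the nonholomorphic terms cancel, because `N / Im (Nτ) = 1 / Im τ`. So `N
E₂(Nτ) - E₂(τ)` is a holomorphic form of weight 2 for `Γ₀(4)`. -/
theorem E2Scale_mem {N : ℕ} [NeZero N] (hN : N ∣ 4) :
    E2Scale N ∈ quasimodularRing (CongruenceSubgroup.Gamma0 4) := by
  have h1 := isSlashBounded_slash_scaleGL E2Star_slash E2Star_bounded hN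
  have h2 := isSlashBounded_slash_scaleGL E2Star_slash E2Star_bounded (one_dvd 4)
  have h3 := h1.sub h2
  have hN0 : (N : ℂ) ≠ 0 := Nat.cast_ne_zero.mpr (NeZero.ne N)
  have heq : (E2Star ∣[(2 : ℤ)] scaleGL ℝ N) - (E2Star ∣[(2 : ℤ)] scaleGL ℝ 1) =
      (N : ℂ) • E2Scale N - EisensteinSeries.E2 := by
    rw [slash_scaleGL, slash_scaleGL]
    funext τ
    have hs : scale 1 τ = τ := by ext1; simp
    have hy : (τ.im : ℂ) ≠ 0 := Complex.ofReal_ne_zero.mpr τ.im_pos.ne'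
    have hpi := Complex.ofReal_ne_zero.mpr Real.pi_ne_zero
    simp only [Pi.sub_apply, Pi.smul_apply, Function.comp_apply, hs, E2Star, E2Scale, smul_eq_mul,
      im_scale]
    norm_num
    field_simp
    ring
  rw [heq] at h3
  have h4 := h3.mem_quasimodularRing
    (((mdifferentiable_comp_scale N E2_mdifferentiable).const_smul (N : ℂ)).sub
      E2_mdifferentiable)
  have hE2 : EisensteinSeries.E2 ∈ quasimodularRing (CongruenceSubgroup.Gamma0 4) :=
    Algebra.subset_adjoin (Or.inr rfl)
  have h5 := Subalgebra.smul_mem _ (Subalgebra.add_mem _ h4 hE2) (N : ℂ)⁻¹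
  rwa [sub_add_cancel, smul_smul, inv_mul_cancel₀ hN0, one_smul] at h5

/-- The generators of the ring of level one quasimodular forms in `2 τ` and `4 τ`. -/
def scaledGenerators : Set (ℍ → ℂ) :=
  {F | ∃ N : ℕ, ∃ _ : NeZero N, N ∣ 4 ∧
    ((∃ k : ℤ, ∃ f : ModularForm 𝒮ℒ k, F = ⇑f ∘ scale N) ∨ F = E2Scale N)}

/-- The ring generated by the quasimodular forms of level one in `N τ`, `N ∣ 4`. -/
def scaledRing : Subalgebra ℂ (ℍ → ℂ) := Algebra.adjoin ℂ scaledGenerators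

theorem scaledRing_le : scaledRing ≤ quasimodularRing (CongruenceSubgroup.Gamma0 4) := by
  refine Algebra.adjoin_le ?_
  rintro _ ⟨N, hN0, hN, ⟨k, f, rfl⟩ | rfl⟩
  · exact modularForm_comp_scale_mem f hN
  · exact E2Scale_mem hN

theorem modularForm_comp_scale_mem_scaledRing {k : ℤ} (f : ModularForm 𝒮ℒ k) {N : ℕ} [h : NeZero N]
    (hN : N ∣ 4) : ⇑f ∘ scale N ∈ scaledRing :=
  Algebra.subset_adjoin ⟨N, h, hN, Or.inl ⟨k, f, rfl⟩⟩

theorem E2Scale_mem_scaledRing {N : ℕ} [h : NeZero N] (hN : N ∣ 4) : E2Scale N ∈ scaledRing :=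
  Algebra.subset_adjoin ⟨N, h, hN, Or.inr rfl⟩

theorem mdifferentiable_E2Scale (N : ℕ) [NeZero N] : MDiff (E2Scale N) :=
  mdifferentiable_comp_scale N E2_mdifferentiable

/-- By the Leibniz rule only generators matter, and there the level one differential equations and
the chain rule for `τ ↦ Nτ` suffice. This is why the proof works in `scaledRing`: no derivative of a
genuine level four form is needed. -/
theorem scaledRing_mdifferentiable_and_deriv {F : ℍ → ℂ} (hF : F ∈ scaledRing) :
    MDiff F ∧ normalizedDerivOfComplex F ∈ scaledRing := by
  induction hF using Algebra.adjoin_induction with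
  | mem F hF =>
    obtain ⟨N, hN0, hN, ⟨k, f, rfl⟩ | rfl⟩ := hF
    · have hf : MDiff (f : ℍ → ℂ) := f.holo'
      refine ⟨mdifferentiable_comp_scale N hf, ?_⟩
      rw [normalizedDeriv_comp_scale N hf]
      obtain ⟨g, hg⟩ := exists_normalizedDeriv_modularForm f
      rw [hg]
      exact Subalgebra.smul_mem _ (Subalgebra.add_mem _ (Subalgebra.smul_mem _ (Subalgebra.mul_mem _
        (E2Scale_mem_scaledRing hN) (modularForm_comp_scale_mem_scaledRing f hN)) _)
        (modularForm_comp_scale_mem_scaledRing g hN)) _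
    · refine ⟨mdifferentiable_E2Scale N, ?_⟩
      rw [E2Scale, normalizedDeriv_comp_scale N E2_mdifferentiable]
      obtain ⟨g, hg⟩ := exists_normalizedDeriv_E2
      rw [hg]
      exact Subalgebra.smul_mem _ (Subalgebra.add_mem _ (Subalgebra.smul_mem _ (Subalgebra.mul_mem _
        (E2Scale_mem_scaledRing hN) (E2Scale_mem_scaledRing hN)) _)
        (modularForm_comp_scale_mem_scaledRing g hN)) _
  | algebraMap r =>
    refine ⟨mdifferentiable_const, ?_⟩
    have : normalizedDerivOfComplex (algebraMap ℂ (ℍ → ℂ) r) = 0 :=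
      normalizedDerivOfComplex_const r
    rw [this]
    exact Subalgebra.zero_mem _
  | add F G hF hG ihF ihG =>
    refine ⟨ihF.1.add ihG.1, ?_⟩
    rw [normalizedDerivOfComplex_add _ _ ihF.1 ihG.1]
    exact Subalgebra.add_mem _ ihF.2 ihG.2
  | mul F G hF hG ihF ihG =>
    refine ⟨ihF.1.mul ihG.1, ?_⟩
    rw [normalizedDerivOfComplex_mul _ _ ihF.1 ihG.1]
    exact Subalgebra.add_mem _ (Subalgebra.mul_mem _ ihF.2 hG) (Subalgebra.mul_mem _ hF ihG.2)

theorem etaQuot_mem_scaledRing : etaQuot ∈ scaledRing := by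
  rw [etaQuot_eq]
  exact Subalgebra.smul_mem _ (Subalgebra.sub_mem _ (Subalgebra.sub_mem _
    (Subalgebra.smul_mem _ (E2Scale_mem_scaledRing (by norm_num)) _)
    (Subalgebra.smul_mem _ (E2Scale_mem_scaledRing (by norm_num)) _))
    (E2Scale_mem_scaledRing (by norm_num))) _

/-- Induction on `D(rA) = (Dr + rL) A`. -/
theorem exists_eq_mul_of_normalizedDeriv {F : ℕ → ℍ → ℂ} {A L : ℍ → ℂ} (hL : L ∈ scaledRing)
    (hA : MDiff A) (hDA : normalizedDerivOfComplex A = L * A)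
    (h0 : ∃ r ∈ scaledRing, F 0 = r * A)
    (hF : ∀ j, F (j + 1) = (2 : ℂ) • normalizedDerivOfComplex (F j)) (j : ℕ) :
    ∃ r ∈ scaledRing, F j = r * A := by
  induction j with
  | zero => exact h0
  | succ j ih =>
    obtain ⟨r, hr, h⟩ := ih
    obtain ⟨hr1, hr2⟩ := scaledRing_mdifferentiable_and_deriv hr
    refine ⟨(2 : ℂ) • (normalizedDerivOfComplex r + r * L), Subalgebra.smul_mem _
      (Subalgebra.add_mem _ hr2 (Subalgebra.mul_mem _ hr hL)) _, ?_⟩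
    rw [hF, h, normalizedDerivOfComplex_mul _ _ hr1 hA, hDA]
    funext τ
    simp
    ring

theorem thetaMoment_false_eq (j : ℕ) :
    ∃ r ∈ scaledRing, thetaMoment false j = r * thetaMoment false 0 := by
  rcases Nat.even_or_odd' j with ⟨i, rfl | rfl⟩
  · refine exists_eq_mul_of_normalizedDeriv (F := fun i => thetaMoment false (2 * i))
      (L := (1 / 6 : ℂ) • (E2Scale 2 - E2Scale 4)) ?_
      (mdifferentiable_thetaMoment _ _) normalizedDeriv_thetaMoment_false_zero
      ⟨1, Subalgebra.one_mem _, (one_mul _).symm⟩ (fun i => thetaMoment_add_two _ _) i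
    exact Subalgebra.smul_mem _ (Subalgebra.sub_mem _ (E2Scale_mem_scaledRing (by norm_num))
      (E2Scale_mem_scaledRing (by norm_num))) _
  · exact ⟨0, Subalgebra.zero_mem _, by rw [zero_mul, thetaMoment_eq_zero (by simp)]⟩

theorem thetaMoment_true_eq (j : ℕ) :
    ∃ r ∈ scaledRing, thetaMoment true j = r * thetaMoment true 1 := by
  rcases Nat.even_or_odd' j with ⟨i, rfl | rfl⟩
  · exact ⟨0, Subalgebra.zero_mem _, by rw [zero_mul, thetaMoment_eq_zero (by simp)]⟩
  · refine exists_eq_mul_of_normalizedDeriv (F := fun i => thetaMoment true (2 * i + 1))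
      (L := (1 / 2 : ℂ) • E2Scale 4) ?_
      (mdifferentiable_thetaMoment _ _) normalizedDeriv_thetaMoment_true_one
      ⟨1, Subalgebra.one_mem _, (one_mul _).symm⟩ (fun i => thetaMoment_add_two _ _) i
    exact Subalgebra.smul_mem _ (E2Scale_mem_scaledRing (by norm_num)) _

end LevelFour

/-! ### Convergence of the Yau-Zaslow generating series -/

section YauZaslow

open Filter Topology
open scoped ComplexOrder

/-- The power series `f` converges absolutely at `x`, with sum `y`. -/
def HasEval (f : PowerSeries ℂ) (x y : ℂ) : Prop :=
  Summable (fun d => ‖PowerSeries.coeff d f * x ^ d‖) ∧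
    HasSum (fun d => PowerSeries.coeff d f * x ^ d) y

theorem HasEval.one (x : ℂ) : HasEval 1 x 1 := by
  have h (d : ℕ) (hd : d ≠ 0) : PowerSeries.coeff d (1 : PowerSeries ℂ) * x ^ d = 0 := by
    simp [PowerSeries.coeff_one, hd]
  constructor
  · refine summable_of_hasFiniteSupport ((Set.finite_singleton 0).subset fun d hd => ?_)
    by_contra h0
    exact hd (by simp only [h d h0, norm_zero])
  · simpa using hasSum_single 0 h

theorem HasEval.mul {f g : PowerSeries ℂ} {x y z : ℂ} (hf : HasEval f x y) (hg : HasEval g x z) :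
    HasEval (f * g) x (y * z) := by
  have h (d : ℕ) : PowerSeries.coeff d (f * g) * x ^ d = ∑ kl ∈ Finset.HasAntidiagonal.antidiagonal d,
      (PowerSeries.coeff kl.1 f * x ^ kl.1) * (PowerSeries.coeff kl.2 g * x ^ kl.2) := by
    rw [PowerSeries.coeff_mul, Finset.sum_mul]
    refine Finset.sum_congr rfl fun kl hkl => ?_
    rw [← Finset.HasAntidiagonal.mem_antidiagonal.mp hkl, pow_add]
    ring
  have hs := summable_norm_sum_mul_antidiagonal_of_summable_norm hf.1 hg.1
  refine ⟨by simpa only [h] using hs, ?_⟩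
  rw [← hf.2.tsum_eq, ← hg.2.tsum_eq, tsum_mul_tsum_eq_tsum_sum_antidiagonal_of_summable_norm
    hf.1 hg.1]
  simpa only [h] using hs.of_norm.hasSum

theorem HasEval.pow {f : PowerSeries ℂ} {x y : ℂ} (hf : HasEval f x y) (m : ℕ) :
    HasEval (f ^ m) x (y ^ m) := by
  induction m with
  | zero => simpa using HasEval.one x
  | succ m ih => simpa only [pow_succ] using ih.mul hf

/-- The geometric series `∑ j, X ^ (k * j)`. -/
def geomSeries (k : ℕ) : PowerSeries ℂ := PowerSeries.mk fun d => if k ∣ d then 1 else 0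

theorem geomSeries_mul {k : ℕ} (hk : k ≠ 0) :
    geomSeries k * (1 - (PowerSeries.X : PowerSeries ℂ) ^ k) = 1 := by
  ext d
  rw [mul_sub, mul_one, map_sub, PowerSeries.coeff_mul_X_pow', geomSeries, PowerSeries.coeff_mk,
    PowerSeries.coeff_one]
  by_cases hkd : k ≤ d
  · have hd : d ≠ 0 := by omega
    rw [if_pos hkd, PowerSeries.coeff_mk, if_neg hd]
    simp [Nat.dvd_sub_iff_left hkd (dvd_refl k)]
  · rw [if_neg hkd, sub_zero]
    congr 1
    rw [eq_iff_iff]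
    refine ⟨fun h => Nat.eq_zero_of_dvd_of_lt h (not_le.mp hkd), fun h => h ▸ dvd_zero k⟩

theorem geomSeries_coeff_nonneg (k d : ℕ) : 0 ≤ PowerSeries.coeff d (geomSeries k) := by
  rw [geomSeries, PowerSeries.coeff_mk]
  split_ifs <;> simp

theorem hasEval_geomSeries {k : ℕ} (hk : k ≠ 0) {x : ℂ} (hx : ‖x‖ < 1) :
    HasEval (geomSeries k) x (1 - x ^ k)⁻¹ := by
  have hxk : ‖x ^ k‖ < 1 := by
    rw [norm_pow]
    exact pow_lt_one₀ (norm_nonneg _) hx hk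
  have hinj : Function.Injective fun j : ℕ => k * j := fun a b h =>
    Nat.eq_of_mul_eq_mul_left (Nat.pos_of_ne_zero hk) h
  have h0 (d : ℕ) (hd : d ∉ Set.range fun j : ℕ => k * j) :
      PowerSeries.coeff d (geomSeries k) * x ^ d = 0 := by
    rw [geomSeries, PowerSeries.coeff_mk, if_neg, zero_mul]
    rintro ⟨j, rfl⟩
    exact hd ⟨j, rfl⟩
  have h1 : (fun d => PowerSeries.coeff d (geomSeries k) * x ^ d) ∘ (fun j : ℕ => k * j) =
      fun j => (x ^ k) ^ j := by
    funext j
    simp [geomSeries, pow_mul]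
  constructor
  · rw [← hinj.summable_iff fun d hd => by rw [h0 d hd, norm_zero]]
    have : (fun d => ‖PowerSeries.coeff d (geomSeries k) * x ^ d‖) ∘ (fun j : ℕ => k * j) =
        fun j => ‖x ^ k‖ ^ j := by
      funext j
      have := congrFun h1 j
      simp only [Function.comp_apply] at this ⊢
      rw [this, norm_pow]
    rw [this]
    exact summable_geometric_of_lt_one (norm_nonneg _) hxk
  · rw [← hinj.hasSum_iff h0, h1]
    exact hasSum_geometric_of_norm_lt_one hxk

/-- The geometric series has nonnegative coefficients, constant term 1, and nothing else below
degree `k`. Thus coefficients of the partial products increase and eventually stabilize, which gives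
both domination and pointwise convergence. -/
theorem coeff_mul_geomSeries_pow {f : PowerSeries ℂ} (hf : ∀ d, 0 ≤ PowerSeries.coeff d f)
    (k m : ℕ) : (∀ d, PowerSeries.coeff d f ≤ PowerSeries.coeff d (f * geomSeries k ^ m)) ∧
      ∀ d < k, PowerSeries.coeff d (f * geomSeries k ^ m) = PowerSeries.coeff d f := by
  induction m with
  | zero => simp
  | succ m ih =>
    have hnn : ∀ d, 0 ≤ PowerSeries.coeff d (f * geomSeries k ^ m) :=
      fun d => (hf d).trans (ih.1 d)
    have h0 : PowerSeries.coeff 0 (geomSeries k) = 1 := by simp [geomSeries]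
    rw [pow_succ, ← mul_assoc]
    constructor
    · intro d
      refine (ih.1 d).trans ?_
      rw [PowerSeries.coeff_mul (φ := f * geomSeries k ^ m)]
      have := Finset.single_le_sum (s := Finset.HasAntidiagonal.antidiagonal d) (a := (d, 0))
        (f := fun kl : ℕ × ℕ => PowerSeries.coeff kl.1 (f * geomSeries k ^ m) *
          PowerSeries.coeff kl.2 (geomSeries k))
        (fun kl _ => mul_nonneg (hnn _) (geomSeries_coeff_nonneg _ _)) (by simp)
      simpa only [h0, mul_one] using this
    · intro d hd
      rw [← ih.2 d hd, PowerSeries.coeff_mul, Finset.sum_eq_single (d, 0)]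
      · rw [h0, mul_one]
      · rintro ⟨i, j⟩ hij hne
        rw [Finset.HasAntidiagonal.mem_antidiagonal] at hij
        simp only at hij
        have hj : j ≠ 0 := by
          rintro rfl
          exact hne (by simp [← hij])
        rw [geomSeries, PowerSeries.coeff_mk, if_neg, mul_zero]
        exact fun h => hj (Nat.eq_zero_of_dvd_of_lt h (by omega))
      · simp

/-- The product of `(1 - X ^ k) ^ (-24)` for `1 ≤ k ≤ K`. -/
def yzPartial (K : ℕ) : PowerSeries ℂ := ∏ k ∈ Finset.range K, geomSeries (k + 1) ^ 24

theorem yzPartial_coeff_nonneg (K d : ℕ) : 0 ≤ PowerSeries.coeff d (yzPartial K) := by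
  induction K generalizing d with
  | zero =>
    rw [yzPartial, Finset.prod_range_zero, PowerSeries.coeff_one]
    split_ifs <;> simp
  | succ K ih =>
    rw [yzPartial, Finset.prod_range_succ]
    exact (ih d).trans ((coeff_mul_geomSeries_pow ih _ _).1 d)

theorem yzPartial_succ (K : ℕ) : yzPartial (K + 1) = yzPartial K * geomSeries (K + 1) ^ 24 :=
  Finset.prod_range_succ _ _

theorem yauZaslow_eq (d : ℕ) : yauZaslow d = PowerSeries.coeff d (yzPartial d) := by
  rw [yauZaslow]
  congr 1
  have h0 : PowerSeries.constantCoeff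
      (∏ k ∈ Finset.Icc 1 d, (1 - (PowerSeries.X : PowerSeries ℂ) ^ k) ^ 24) ≠ 0 := by
    rw [map_prod, Finset.prod_ne_zero_iff]
    intro k hk
    have : k ≠ 0 := by have := (Finset.mem_Icc.mp hk).1; omega
    simp [this]
  rw [eq_comm, PowerSeries.eq_inv_iff_mul_eq_one h0, yzPartial, Finset.range_eq_Ico,
    Finset.prod_Ico_add' (fun k => geomSeries k ^ 24) 0 d 1, zero_add,
    Finset.Ico_add_one_right_eq_Icc, ← Finset.prod_mul_distrib]
  refine Finset.prod_eq_one fun k hk => ?_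
  rw [← mul_pow, geomSeries_mul (by have := (Finset.mem_Icc.mp hk).1; omega), one_pow]

theorem yzPartial_coeff_of_le {d K : ℕ} (h : d ≤ K) :
    PowerSeries.coeff d (yzPartial K) = yauZaslow d := by
  rw [yauZaslow_eq]
  induction K, h using Nat.le_induction with
  | base => rfl
  | succ K hK ih =>
    rw [yzPartial_succ, (coeff_mul_geomSeries_pow (yzPartial_coeff_nonneg K) _ _).2 d (by omega),
      ih]

theorem yzPartial_coeff_le (d K : ℕ) : PowerSeries.coeff d (yzPartial K) ≤ yauZaslow d := by
  have hmono : Monotone fun K => PowerSeries.coeff d (yzPartial K) :=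
    monotone_nat_of_le_succ fun K => by
      rw [yzPartial_succ]
      exact (coeff_mul_geomSeries_pow (yzPartial_coeff_nonneg K) _ _).1 d
  rw [← yzPartial_coeff_of_le (le_max_left d K)]
  exact hmono (le_max_right d K)

theorem yauZaslow_nonneg (d : ℕ) : 0 ≤ yauZaslow d :=
  yauZaslow_eq d ▸ yzPartial_coeff_nonneg d d

theorem hasEval_yzPartial (K : ℕ) {x : ℂ} (hx : ‖x‖ < 1) :
    HasEval (yzPartial K) x (qPoch x K ^ 24)⁻¹ := by
  induction K with
  | zero => simpa [yzPartial, qPoch] using HasEval.one x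
  | succ K ih =>
    have := ih.mul ((hasEval_geomSeries K.succ_ne_zero hx).pow 24)
    rw [yzPartial_succ]
    convert this using 1
    rw [qPoch, Finset.prod_range_succ, ← qPoch, mul_pow, mul_inv, inv_pow]

theorem tendsto_yzPartial {x : ℂ} (hx : ‖x‖ < 1) :
    Tendsto (fun K => (qPoch x K ^ 24)⁻¹) atTop (𝓝 (eulerProd x ^ 24)⁻¹) :=
  ((tendsto_qPoch hx).pow 24).inv₀ (pow_ne_zero _ (eulerProd_ne_zero hx))

/-- By positivity, the partial sums of norms are bounded by the values of finite products at the
real point `‖x‖`, and these converge. -/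
theorem summable_norm_yauZaslow {x : ℂ} (hx : ‖x‖ < 1) :
    Summable fun d => ‖yauZaslow d * x ^ d‖ := by
  have hr : ‖((‖x‖ : ℝ) : ℂ)‖ < 1 := by simpa using hx
  obtain ⟨C, hC⟩ := (tendsto_yzPartial hr).norm.bddAbove_range
  refine summable_of_sum_range_le (c := C) (fun _ => norm_nonneg _) fun D => ?_
  have h := hasEval_yzPartial D hr
  have hreal (d : ℕ) : PowerSeries.coeff d (yzPartial D) * ((‖x‖ : ℝ) : ℂ) ^ d =
      ((‖PowerSeries.coeff d (yzPartial D) * x ^ d‖ : ℝ) : ℂ) := by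
    rw [norm_mul, norm_pow, Complex.ofReal_mul, Complex.ofReal_pow,
      Complex.norm_of_nonneg' (yzPartial_coeff_nonneg D d)]
  have hs := h.1
  simp only [hreal, Complex.norm_real, norm_norm] at hs
  have htsum := h.2.tsum_eq
  simp only [hreal] at htsum
  rw [← Complex.ofReal_tsum] at htsum
  calc ∑ d ∈ Finset.range D, ‖yauZaslow d * x ^ d‖
      = ∑ d ∈ Finset.range D, ‖PowerSeries.coeff d (yzPartial D) * x ^ d‖ :=
        Finset.sum_congr rfl fun d hd => by
          rw [yzPartial_coeff_of_le (Finset.mem_range.mp hd).le]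
    _ ≤ ∑' d, ‖PowerSeries.coeff d (yzPartial D) * x ^ d‖ :=
        hs.sum_le_tsum _ fun _ _ => norm_nonneg _
    _ ≤ ‖(qPoch ((‖x‖ : ℝ) : ℂ) D ^ 24)⁻¹‖ := by
        rw [← htsum, Complex.norm_real]
        exact Real.le_norm_self _
    _ ≤ C := hC ⟨D, rfl⟩

/-- The generating series of the Yau-Zaslow numbers. -/
theorem hasSum_yauZaslow {x : ℂ} (hx : ‖x‖ < 1) :
    HasSum (fun d => yauZaslow d * x ^ d) (eulerProd x ^ 24)⁻¹ := by
  have hs := summable_norm_yauZaslow hx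
  have h := tendsto_tsum_of_dominated_convergence (𝓕 := atTop)
    (f := fun K d => PowerSeries.coeff d (yzPartial K) * x ^ d)
    (g := fun d => yauZaslow d * x ^ d) hs
    (fun d => tendsto_const_nhds.congr' ((eventually_ge_atTop d).mono fun K hK => by
      simp only [yzPartial_coeff_of_le hK]))
    (Eventually.of_forall fun K d => by
      rw [norm_mul, norm_mul]
      refine mul_le_mul_of_nonneg_right ?_ (norm_nonneg _)
      have h1 := yzPartial_coeff_le d K
      rw [← Complex.norm_of_nonneg' (yzPartial_coeff_nonneg K d),
        ← Complex.norm_of_nonneg' (yauZaslow_nonneg d)] at h1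
      exact_mod_cast h1)
  simp only [(hasEval_yzPartial _ hx).2.tsum_eq] at h
  rw [tendsto_nhds_unique (tendsto_yzPartial hx) h]
  exact hs.of_norm.hasSum

theorem k3Invariant_two_mul_sub_two (d : ℕ) : k3Invariant (2 * (d : ℚ) - 2) = yauZaslow d := by
  have h : ∃ d' : ℕ, 2 * (d : ℚ) - 2 = 2 * (d' : ℚ) - 2 := ⟨d, rfl⟩
  rw [k3Invariant, dif_pos h]
  congr 1
  have := h.choose_spec
  have h2 : (d : ℚ) = (h.choose : ℚ) := by linarith
  exact_mod_cast h2.symm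

end YauZaslow

/-! ### Finite products of absolutely convergent series -/

section ProductsOfSums

/-- A product of absolutely convergent series, indexed by `Fin n`, is a sum over functions. -/
theorem hasSum_prod_fin {β : Type*} (n : ℕ) (f : Fin n → β → ℂ) (y : Fin n → ℂ)
    (hs : ∀ i, Summable fun b => ‖f i b‖) (hy : ∀ i, HasSum (f i) (y i)) :
    (Summable fun b : Fin n → β => ‖∏ i, f i (b i)‖) ∧
      HasSum (fun b : Fin n → β => ∏ i, f i (b i)) (∏ i, y i) := by
  induction n with
  | zero =>
    constructor
    · exact (hasSum_fintype _).summable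
    · simp
  | succ n ih =>
    obtain ⟨h1, h2⟩ := ih (fun i => f i.succ) (fun i => y i.succ) (fun i => hs _) (fun i => hy _)
    have hsum := (summable_mul_of_summable_norm (hs 0) h1)
    have hsumn : Summable fun x : β × (Fin n → β) => ‖f 0 x.1 * ∏ i, f i.succ (x.2 i)‖ := by
      simpa only [norm_mul] using (hs 0).mul_of_nonneg h1 (fun _ => norm_nonneg _)
        (fun _ => norm_nonneg _)
    have hprod := (hy 0).mul h2 hsum
    have heq (x : β × (Fin n → β)) : ∏ i, f i (Fin.consEquiv (fun _ => β) x i) =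
        f 0 x.1 * ∏ i, f i.succ (x.2 i) := by
      rw [Fin.prod_univ_succ]
      simp [Fin.consEquiv]
    constructor
    · rw [← (Fin.consEquiv fun _ => β).summable_iff]
      simpa only [Function.comp_def, heq] using hsumn
    · rw [← (Fin.consEquiv fun _ => β).hasSum_iff, Fin.prod_univ_succ]
      simpa only [Function.comp_def, heq] using hprod

/-- A finite product of absolutely convergent series is a sum over functions. -/
theorem hasSum_prod_pi {ι β : Type*} [Fintype ι] (f : ι → β → ℂ) (y : ι → ℂ)
    (hs : ∀ i, Summable fun b => ‖f i b‖) (hy : ∀ i, HasSum (f i) (y i)) :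
    (Summable fun b : ι → β => ‖∏ i, f i (b i)‖) ∧
      HasSum (fun b : ι → β => ∏ i, f i (b i)) (∏ i, y i) := by
  let e := Fintype.equivFin ι
  obtain ⟨h1, h2⟩ := hasSum_prod_fin _ (fun i => f (e.symm i)) (fun i => y (e.symm i))
    (fun i => hs _) (fun i => hy _)
  have heq (b : ι → β) : ∏ i, f (e.symm i) (e.arrowCongr (Equiv.refl β) b i) = ∏ i, f i (b i) := by
    rw [← e.symm.prod_comp fun i => f i (b i)]
    rfl
  rw [← (e.arrowCongr (Equiv.refl β)).summable_iff] at h1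
  rw [← (e.arrowCongr (Equiv.refl β)).hasSum_iff, e.symm.prod_comp y] at h2
  simp only [Function.comp_def, heq] at h1 h2
  exact ⟨h1, h2⟩

end ProductsOfSums

/-! ### Parity patterns of vectors in the Kummer lattice -/

section KummerSets

/-- The solution set of the affine equation `∑ i, l i * v i = c`. -/
def affineSet (l : Fin 4 → ZMod 2) (c : ZMod 2) : Finset TwoTorsion :=
  Finset.univ.filter fun v => ∑ i, l i * v i = c

/-- All three cases become one affine equation, `0 = 1` and `0 = 0` being the degenerate ones; a
direction of dimension 3 is the kernel of a nonzero functional. This makes the parity patterns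
accessible to a finite check. -/
theorem exists_affineSet_of_mem_kummerLattice {a : TwoTorsion → ℤ} (ha : a ∈ kummerLattice) :
    ∃ l c, {v | Odd (a v)} = (affineSet l c : Set TwoTorsion) := by
  rcases ha with h | ⟨P, hP, h⟩ | h
  · exact ⟨0, 1, by rw [h]; simp [affineSet]⟩
  · have hne : (P : Set TwoTorsion).Nonempty := by
      rw [AffineSubspace.nonempty_iff_ne_bot]
      intro hbot
      rw [hbot, AffineSubspace.direction_bot, finrank_bot] at hP
      omega
    obtain ⟨p, hp⟩ := hne
    have hlt : P.direction < ⊤ := by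
      rw [lt_top_iff_ne_top]
      intro ht
      rw [ht] at hP
      simp at hP
    obtain ⟨f, hf, hle⟩ := Submodule.exists_le_ker_of_lt_top _ hlt
    have hker : P.direction = LinearMap.ker f := by
      refine Submodule.eq_of_le_of_finrank_le hle ?_
      have h1 := Submodule.finrank_lt (fun h => hf (LinearMap.ker_eq_top.mp h) : LinearMap.ker f ≠ ⊤)
      rw [hP]
      simp at h1
      omega
    have hsum (v : TwoTorsion) : f v = ∑ i, f (Pi.single i 1) * v i := by
      have h1 := LinearMap.pi_apply_eq_sum_univ f v
      simp only [smul_eq_mul] at h1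
      rw [h1]
      refine Finset.sum_congr rfl fun i _ => ?_
      rw [mul_comm]
      congr 2
      ext j
      simp [Pi.single_apply, eq_comm]
    refine ⟨fun i => f (Pi.single i 1), f p, ?_⟩
    rw [h]
    ext v
    simp only [affineSet, Finset.coe_filter, Finset.mem_univ, true_and, Set.mem_ofPred_eq, ← hsum]
    rw [SetLike.mem_coe, ← AffineSubspace.vsub_right_mem_direction_iff_mem hp, hker,
      LinearMap.mem_ker, vsub_eq_sub, map_sub, sub_eq_zero]
  · exact ⟨0, 0, by rw [h]; simp [affineSet]⟩

/-- The set `eps n` for `n` even (`p = false`) or odd (`p = true`), as a finite set. -/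
def epsFinset (p : Bool) : Finset TwoTorsion :=
  let A := Finset.univ.filter fun v : TwoTorsion => v 2 = 0 ∧ v 3 = 0
  if p then symmDiff A (Finset.univ.filter fun v : TwoTorsion => v 0 = 0 ∧ v 1 = 0) else A

theorem coe_epsFinset (n : ℕ) : (epsFinset (decide (Odd n)) : Set TwoTorsion) = eps n := by
  by_cases h : Even n
  · have h' : ¬ Odd n := Nat.not_odd_iff_even.mpr h
    simp [epsFinset, eps, h, h', eps0]
  · have h' : Odd n := Nat.not_even_iff_odd.mp h
    simp [epsFinset, eps, h, h', eps0, eps1, eps1Star, Finset.coe_symmDiff]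

/-- The set of `v` with `b v` odd. -/
def oddSet (b : TwoTorsion → ℤ) : Finset TwoTorsion := Finset.univ.filter fun v => Odd (b v)

theorem mem_oddSet {b : TwoTorsion → ℤ} {v : TwoTorsion} : v ∈ oddSet b ↔ Odd (b v) := by
  simp [oddSet]

theorem coe_oddSet (b : TwoTorsion → ℤ) : (oddSet b : Set TwoTorsion) = {v | Odd (b v)} := by
  simp [oddSet]

theorem oddSet_shifted (n : ℕ) (a : TwoTorsion → ℤ) :
    oddSet (shifted n a) = symmDiff (oddSet a) (epsFinset (decide (Odd n))) := by
  ext v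
  rw [Finset.mem_symmDiff, mem_oddSet, mem_oddSet, ← Finset.mem_coe (s := epsFinset _),
    coe_epsFinset, shifted]
  split_ifs with h
  · simp only [h, not_true_eq_false, and_false, true_and, false_or, Int.not_odd_iff_even]
    rw [Int.odd_sub]
    simp
  · simp [h]

open Classical in
/-- The sets of `v` with `b v` odd, for the vectors `b = shifted n a` with `a` in the Kummer lattice
and `n` even (`p = false`) or odd (`p = true`). -/
def oddSets (p : Bool) : Finset (Finset TwoTorsion) :=
  Finset.univ.filter fun O => ∃ a ∈ kummerLattice, O = symmDiff (oddSet a) (epsFinset p)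

theorem mem_oddSets {p : Bool} {O : Finset TwoTorsion} :
    O ∈ oddSets p ↔ ∃ a ∈ kummerLattice, O = symmDiff (oddSet a) (epsFinset p) := by
  simp [oddSets]

theorem mem_kummerLattice_iff (n : ℕ) (a : TwoTorsion → ℤ) :
    a ∈ kummerLattice ↔ oddSet (shifted n a) ∈ oddSets (decide (Odd n)) := by
  rw [oddSet_shifted, mem_oddSets]
  refine ⟨fun h => ⟨a, h, rfl⟩, fun ⟨a', ha', h⟩ => ?_⟩
  have h' := congrArg (fun s : Finset TwoTorsion => (s : Set TwoTorsion)) (symmDiff_left_injective _ h)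
  simp only [coe_oddSet] at h'
  simpa only [kummerLattice, Set.mem_ofPred_eq, h'] using ha'

/-- A check of 32 equations for each parity. The bound `2 ≤ h` later keeps the exponent `h - 2` of
the eta quotient nonnegative, and the parity of `h` is that of `n`. -/
theorem card_symmDiff_affineSet : ∀ p : Bool, ∀ lc : (Fin 4 → ZMod 2) × ZMod 2,
    ∃ h : Fin 9, (symmDiff (affineSet lc.1 lc.2) (epsFinset p)).card = 2 * h.val ∧ 2 ≤ h.val ∧
      decide (Odd h.val) = p := by
  decide +kernel

theorem card_of_mem_oddSets {p : Bool} {O : Finset TwoTorsion} (hO : O ∈ oddSets p) :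
    ∃ h, O.card = 2 * h ∧ 2 ≤ h ∧ decide (Odd h) = p := by
  obtain ⟨a, ha, rfl⟩ := mem_oddSets.mp hO
  obtain ⟨l, c, h⟩ := exists_affineSet_of_mem_kummerLattice ha
  rw [← coe_oddSet, Finset.coe_inj] at h
  rw [h]
  obtain ⟨h, hh⟩ := card_symmDiff_affineSet p (l, c)
  exact ⟨h, hh⟩

/-- Modulo 4 a square is 1 or 0 according to parity. -/
theorem sum_sq_of_oddSet_eq {O : Finset TwoTorsion} {h : ℕ} (hO : O.card = 2 * h)
    {b : TwoTorsion → ℤ} (hb : oddSet b = O) : ∃ j : ℕ, ∑ v, b v ^ 2 = 2 * (h + 2 * j : ℕ) := by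
  have hv (v : TwoTorsion) : ∃ j : ℕ, b v ^ 2 = (if v ∈ O then 1 else 0) + 4 * (j : ℤ) := by
    rw [← hb]
    simp only [mem_oddSet]
    split_ifs with hodd
    · obtain ⟨i, hi⟩ := hodd
      refine ⟨(i ^ 2 + i).toNat, ?_⟩
      rw [Int.toNat_of_nonneg (by nlinarith [sq_nonneg (2 * i + 1)]), hi]
      ring
    · obtain ⟨i, hi⟩ := Int.not_odd_iff_even.mp hodd
      refine ⟨(i ^ 2).toNat, ?_⟩
      rw [Int.toNat_of_nonneg (sq_nonneg i), hi]
      ring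
  choose j hj using hv
  refine ⟨∑ v, j v, ?_⟩
  simp only [hj, Finset.sum_add_distrib, Finset.sum_ite_mem, Finset.univ_inter,
    Finset.sum_const, hO, ← Finset.mul_sum]
  push_cast
  simp
  ring

theorem even_sum_of_oddSet_eq {O : Finset TwoTorsion} {h : ℕ} (hO : O.card = 2 * h)
    {b : TwoTorsion → ℤ} (hb : oddSet b = O) : Even (∑ v, b v) := by
  obtain ⟨j, hj⟩ := sum_sq_of_oddSet_eq hO hb
  have h1 : Even (∑ v, (b v ^ 2 - b v)) := by
    refine Finset.even_sum _ fun v _ => ?_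
    rw [sq, ← mul_sub_one]
    exact Int.even_mul_pred_self (b v)
  rw [Finset.sum_sub_distrib, hj, Int.even_sub] at h1
  exact h1.mp (even_two_mul _)

end KummerSets

/-! ### Factorization of the potential into theta moments -/

section OrbifoldSeries

open Filter Topology Complex
open UpperHalfPlane hiding I
open scoped Real

/-- The coefficient of `∏ v, z_v ^ m v` in the contribution of `b = shifted n a` to the coefficient
of `u ^ n` of the orbifold potential. -/
def orbCoeff (m : TwoTorsion →₀ ℕ) (n : ℕ) (b : TwoTorsion → ℤ) : ℂ :=
  k3Invariant ((n : ℚ) - 1 / 2 * ∑ v, (b v : ℚ) ^ 2) * (-1 : ℂ) ^ ((∑ v, b v) / 2) *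
    ∏ v, (I * b v / 2) ^ m v / ((m v).factorial : ℂ)

theorem coeff_orbTerm (m : TwoTorsion →₀ ℕ) (n : ℕ) (a : TwoTorsion → ℤ) :
    MvPowerSeries.coeff m (orbTerm n a) = orbCoeff m n (shifted n a) := by
  rw [orbTerm, MvPowerSeries.coeff_smul]
  rfl

theorem exists_of_k3Invariant_ne_zero {s : ℚ} (h : k3Invariant s ≠ 0) :
    ∃ d : ℕ, s = 2 * (d : ℚ) - 2 := by
  by_contra h0
  exact h (by simp [k3Invariant, h0])

theorem finite_support_orbCoeff (m : TwoTorsion →₀ ℕ) (n : ℕ) :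
    (Function.support (orbCoeff m n)).Finite := by
  have hfin : (Set.pi Set.univ fun _ : TwoTorsion =>
      Set.Icc (-(2 * (n : ℤ) + 4)) (2 * (n : ℤ) + 4)).Finite :=
    Set.Finite.pi fun _ => Set.finite_Icc _ _
  refine hfin.subset fun b hb v _ => ?_
  obtain ⟨d, hd⟩ := exists_of_k3Invariant_ne_zero (left_ne_zero_of_mul (left_ne_zero_of_mul hb))
  have h3 : (b v : ℚ) ^ 2 ≤ ∑ v, (b v : ℚ) ^ 2 :=
    Finset.single_le_sum (f := fun v => (b v : ℚ) ^ 2) (fun _ _ => sq_nonneg _) (Finset.mem_univ v)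
  have h4 : (0 : ℚ) ≤ d := Nat.cast_nonneg d
  have h5 : (b v : ℚ) ^ 2 ≤ 2 * n + 4 := by linarith
  have h6 : b v ^ 2 ≤ 2 * (n : ℤ) + 4 := by exact_mod_cast h5
  constructor <;> nlinarith

/-- The sum of `orbCoeff m n b` over all `b` with a given set of odd entries. -/
def orbSum (m : TwoTorsion →₀ ℕ) (O : Finset TwoTorsion) (n : ℕ) : ℂ :=
  ∑' b : {b // oddSet b = O}, orbCoeff m n b

theorem hasSum_orbSum (m : TwoTorsion →₀ ℕ) (O : Finset TwoTorsion) (n : ℕ) :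
    HasSum (fun b : {b // oddSet b = O} => orbCoeff m n b) (orbSum m O n) :=
  ((summable_of_hasFiniteSupport (finite_support_orbCoeff m n)).subtype {b | oddSet b = O}).hasSum

theorem sum_sq_half_cast {O : Finset TwoTorsion} {h : ℕ} (hO : O.card = 2 * h)
    {b : TwoTorsion → ℤ} (hb : oddSet b = O) :
    ∃ j : ℕ, 1 / 2 * ∑ v, (b v : ℚ) ^ 2 = (h + 2 * j : ℕ) := by
  obtain ⟨j, hj⟩ := sum_sq_of_oddSet_eq hO hb
  refine ⟨j, ?_⟩
  have : ∑ v, (b v : ℚ) ^ 2 = ((∑ v, b v ^ 2 : ℤ) : ℚ) := by push_cast; rfl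
  rw [this, hj]
  push_cast
  ring

/-- A nonzero invariant forces `n + 2 = 2d + h + 2j`, hence `n ≡ h mod 2`. -/
theorem orbSum_eq_zero (m : TwoTorsion →₀ ℕ) {O : Finset TwoTorsion} {h n : ℕ}
    (hO : O.card = 2 * h) (hn : decide (Odd h) ≠ decide (Odd n)) : orbSum m O n = 0 := by
  rw [orbSum]
  convert tsum_zero with b
  by_contra h0
  obtain ⟨d, hd⟩ := exists_of_k3Invariant_ne_zero (left_ne_zero_of_mul (left_ne_zero_of_mul h0))
  obtain ⟨j, hj⟩ := sum_sq_half_cast hO b.2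
  rw [hj] at hd
  have h1 : n + 2 = 2 * d + (h + 2 * j) := by
    have : (n : ℚ) + 2 = 2 * d + (h + 2 * j : ℕ) := by linarith
    exact_mod_cast this
  apply hn
  rw [decide_eq_decide, Nat.odd_iff, Nat.odd_iff]
  omega

/-- The sum over the Kummer lattice, as a sum over the possible sets of odd entries. -/
theorem tsum_kummerLattice (m : TwoTorsion →₀ ℕ) (n : ℕ) :
    ∑' a : kummerLattice, orbCoeff m n (shifted n a) =
      ∑ O ∈ oddSets (decide (Odd n)), orbSum m O n := by
  classical
  have hbij : Function.Bijective (shifted n) := by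
    rw [Function.bijective_iff_has_inverse]
    refine ⟨fun b v => b v + if v ∈ eps n then 1 else 0, fun a => ?_, fun b => ?_⟩ <;> funext v <;>
      simp [shifted]
  have hs : Summable (orbCoeff m n) := summable_of_hasFiniteSupport (finite_support_orbCoeff m n)
  have e1 : ∑' a : kummerLattice, orbCoeff m n (shifted n a) =
      ∑' b, if oddSet b ∈ oddSets (decide (Odd n)) then orbCoeff m n b else 0 := by
    rw [← (Equiv.ofBijective _ hbij).tsum_eq, tsum_subtype kummerLattice
      fun a => orbCoeff m n (shifted n a)]
    refine tsum_congr fun a => ?_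
    simp only [Set.indicator_apply, mem_kummerLattice_iff n a, Equiv.ofBijective_apply]
  have e2 (O : Finset TwoTorsion) : orbSum m O n =
      ∑' b, if oddSet b = O then orbCoeff m n b else 0 := by
    rw [orbSum]
    refine (tsum_subtype {b | oddSet b = O} (orbCoeff m n)).trans (tsum_congr fun b => ?_)
    simp [Set.indicator_apply]
  simp only [e1, e2]
  rw [← Summable.tsum_finsetSum]
  · refine tsum_congr fun b => ?_
    rw [Finset.sum_ite_eq]
  · intro O _
    have := hs.indicator {b | oddSet b = O}
    refine this.congr fun b => ?_
    simp [Set.indicator_apply]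

/-- Patterns of the wrong parity contribute zero, so they may be added to make the index set
independent of `n`; for the others `s^n = s^(|O|/2)`. -/
theorem coeff_orbPotential (s : ℤˣ) (m : TwoTorsion →₀ ℕ) (n : ℕ) :
    MvPowerSeries.coeff m (orbPotential s n) =
      ∑ O ∈ oddSets false ∪ oddSets true, ((s : ℤ) : ℂ) ^ (O.card / 2) * orbSum m O n := by
  have e1 : MvPowerSeries.coeff m (orbPotential s n) =
      ((s : ℤ) : ℂ) ^ n * ∑ O ∈ oddSets (decide (Odd n)), orbSum m O n := by
    rw [orbPotential, MvPowerSeries.coeff_smul, ← tsum_kummerLattice]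
    congr 1
    have h1 := map_finsum (MvPowerSeries.coeff (R := ℂ) m) (finite_support_orbTerm n)
    rw [h1, tsum_eq_finsum]
    · exact finsum_congr fun a => coeff_orbTerm m n a
    · refine (finite_support_orbTerm n).subset fun a ha h0 => ha ?_
      simp only [← coeff_orbTerm] at h0 ⊢
      rw [h0, map_zero]
  rw [e1, Finset.mul_sum]
  have hs (h : ℕ) (hh : decide (Odd h) = decide (Odd n)) :
      ((s : ℤ) : ℂ) ^ n = ((s : ℤ) : ℂ) ^ h := by
    rw [decide_eq_decide] at hh
    rcases Int.units_eq_one_or s with rfl | rfl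
    · simp
    · rcases Nat.even_or_odd n with hn | hn
      · have : Even h := by
          rw [← Nat.not_odd_iff_even] at hn ⊢
          rwa [hh]
        simp [hn.neg_one_pow, this.neg_one_pow]
      · simp [hn.neg_one_pow, (hh.mpr hn).neg_one_pow]
  rw [← Finset.sum_subset (s₁ := oddSets (decide (Odd n))) (s₂ := oddSets false ∪ oddSets true)]
  · refine Finset.sum_congr rfl fun O hO => ?_
    obtain ⟨h, hc, -, hh⟩ := card_of_mem_oddSets hO
    rw [hc, Nat.mul_div_cancel_left _ two_pos, hs h hh]
  · cases decide (Odd n)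
    · exact Finset.subset_union_left
    · exact Finset.subset_union_right
  · intro O hO hOn
    have : ∃ p, O ∈ oddSets p := by
      rcases Finset.mem_union.mp hO with h | h
      exacts [⟨_, h⟩, ⟨_, h⟩]
    obtain ⟨p, hp⟩ := this
    obtain ⟨h, hc, -, hh⟩ := card_of_mem_oddSets hp
    rw [orbSum_eq_zero m hc, mul_zero]
    rintro hne
    rw [hh] at hne
    exact hOn (hne ▸ hp)

theorem I_zpow_sum {ι : Type*} (t : Finset ι) (b : ι → ℤ) :
    ∏ v ∈ t, I ^ b v = I ^ (∑ v ∈ t, b v) := by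
  classical
  induction t using Finset.induction_on with
  | empty => simp
  | insert a t ha ih => rw [Finset.prod_insert ha, Finset.sum_insert ha, ih, zpow_add₀ I_ne_zero]

/-- The sign and the power of `u` both become local in `v`: `(-1)^(½ ∑ b_v) = ∏ i^(b_v)` and `u^(½ ∑
b_v²) = ∏ exp (π i b_v² τ)`. -/
theorem prod_momentCoeff_eq {O : Finset TwoTorsion} {h : ℕ} (hO : O.card = 2 * h)
    {b : TwoTorsion → ℤ} (hb : oddSet b = O) {N : ℕ} (hN : 1 / 2 * ∑ v, (b v : ℚ) ^ 2 = N)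
    (m : TwoTorsion →₀ ℕ) (τ : ℍ) :
    ∏ v, momentCoeff (decide (v ∈ O)) (m v) (b v) * cexp (π * I * (1 : ℕ) * (b v : ℂ) ^ 2 * τ) =
      (-1 : ℂ) ^ ((∑ v, b v) / 2) * (∏ v, (b v : ℂ) ^ m v) * qVar τ ^ N := by
  have h1 (v : TwoTorsion) : momentCoeff (decide (v ∈ O)) (m v) (b v) =
      I ^ b v * (b v : ℂ) ^ m v := by
    rw [momentCoeff, if_pos]
    rw [decide_eq_decide, ← hb, mem_oddSet]
  obtain ⟨k, hk⟩ := even_sum_of_oddSet_eq hO hb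
  have h2 : (∑ v, b v) / 2 = k := by omega
  simp only [h1]
  rw [Finset.prod_mul_distrib, Finset.prod_mul_distrib, I_zpow_sum, h2, hk, ← Complex.exp_sum,
    zpow_add₀ I_ne_zero, ← mul_zpow, I_mul_I]
  congr 1
  rw [qVar, ← Complex.exp_nat_mul]
  congr 1
  have h3 : ∑ v, (b v : ℂ) ^ 2 = 2 * N := by
    have h4 : ∑ v, (b v : ℚ) ^ 2 = 2 * N := by linarith
    have h5 : ∑ v, b v ^ 2 = 2 * (N : ℤ) := by exact_mod_cast h4
    exact_mod_cast congrArg (Int.cast : ℤ → ℂ) h5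
  rw [← Finset.sum_mul, ← Finset.mul_sum, h3]
  push_cast
  ring

theorem prod_momentCoeff_eq_zero {O : Finset TwoTorsion} {b : TwoTorsion → ℤ} (hb : oddSet b ≠ O)
    (m : TwoTorsion →₀ ℕ) (τ : ℍ) :
    ∏ v, momentCoeff (decide (v ∈ O)) (m v) (b v) * cexp (π * I * (1 : ℕ) * (b v : ℂ) ^ 2 * τ) =
      0 := by
  have : ∃ v, ¬ (v ∈ oddSet b ↔ v ∈ O) := by
    by_contra! h
    exact hb (Finset.ext h)
  obtain ⟨v, hv⟩ := this
  refine Finset.prod_eq_zero (Finset.mem_univ v) ?_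
  rw [momentCoeff, if_neg, zero_mul]
  rwa [decide_eq_decide, ← mem_oddSet]

theorem hasSum_prod_momentCoeff (O : Finset TwoTorsion) (m : TwoTorsion →₀ ℕ) (τ : ℍ) :
    (Summable fun b : {b // oddSet b = O} => ‖∏ v, momentCoeff (decide (v ∈ O)) (m v) (b.1 v) *
        cexp (π * I * (1 : ℕ) * (b.1 v : ℂ) ^ 2 * τ)‖) ∧
      HasSum (fun b : {b // oddSet b = O} => ∏ v, momentCoeff (decide (v ∈ O)) (m v) (b.1 v) *
        cexp (π * I * (1 : ℕ) * (b.1 v : ℂ) ^ 2 * τ))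
        (∏ v, thetaMoment (decide (v ∈ O)) (m v) τ) := by
  have hs (v : TwoTorsion) := summable_norm_thetaSeries_term one_pos
    (norm_momentCoeff_le (decide (v ∈ O)) (m v)) τ
  obtain ⟨h1, h2⟩ := hasSum_prod_pi _ (fun v => thetaMoment (decide (v ∈ O)) (m v) τ) hs
    fun v => (hs v).of_norm.hasSum
  refine ⟨h1.subtype {b | oddSet b = O}, ?_⟩
  refine (hasSum_subtype_iff_of_support_subset (s := {b | oddSet b = O}) fun b hb => ?_).mpr h2
  by_contra h0
  exact hb (prod_momentCoeff_eq_zero h0 m τ)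

theorem etaScale_two_pow (τ : ℍ) :
    (etaScale 2 τ ^ 24)⁻¹ = (qVar τ ^ 2)⁻¹ * (eulerProd (qVar τ ^ 2) ^ 24)⁻¹ := by
  rw [etaScale_eq, mul_pow, mul_inv, ← Complex.exp_nat_mul, qVar, ← Complex.exp_nat_mul]
  congr 3
  push_cast
  ring

/-- The constant relating `orbCoeff` to moments of theta functions. -/
def orbConst (m : TwoTorsion →₀ ℕ) : ℂ := ∏ v, (I / 2) ^ m v / ((m v).factorial : ℂ)

theorem orbCoeff_mul_pow {O : Finset TwoTorsion} {h : ℕ} (hO : O.card = 2 * h) (hh : 2 ≤ h)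
    {b : TwoTorsion → ℤ} (hb : oddSet b = O) {j : ℕ}
    (hj : 1 / 2 * ∑ v, (b v : ℚ) ^ 2 = (h + 2 * j : ℕ)) (m : TwoTorsion →₀ ℕ) (τ : ℍ) (d : ℕ) :
    orbConst m * (qVar τ ^ 2)⁻¹ * (yauZaslow d * (qVar τ ^ 2) ^ d *
      ∏ v, momentCoeff (decide (v ∈ O)) (m v) (b v) *
        cexp (π * I * (1 : ℕ) * (b v : ℂ) ^ 2 * τ)) =
      orbCoeff m (2 * d + (h + 2 * j) - 2) b * qVar τ ^ (2 * d + (h + 2 * j) - 2) := by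
  have e1 : ((2 * d + (h + 2 * j) - 2 : ℕ) : ℚ) - 1 / 2 * ∑ v, (b v : ℚ) ^ 2 =
      2 * (d : ℚ) - 2 := by
    rw [hj, Nat.cast_sub (by omega)]
    push_cast
    ring
  have e2 : qVar τ ^ (2 * d + (h + 2 * j) - 2) =
      (qVar τ ^ 2)⁻¹ * ((qVar τ ^ 2) ^ d * qVar τ ^ (h + 2 * j)) := by
    rw [eq_inv_mul_iff_mul_eq₀ (pow_ne_zero 2 (qVar_ne_zero τ)), ← pow_mul, ← pow_add, ← pow_add]
    congr 1
    omega
  have e3 : ∏ v, (I * (b v : ℂ) / 2) ^ m v / ((m v).factorial : ℂ) =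
      orbConst m * ∏ v, (b v : ℂ) ^ m v := by
    rw [orbConst, ← Finset.prod_mul_distrib]
    refine Finset.prod_congr rfl fun v _ => ?_
    rw [mul_div_right_comm, mul_pow]
    ring
  rw [prod_momentCoeff_eq hO hb hj m τ, orbCoeff, e1, k3Invariant_two_mul_sub_two, e2, e3]
  ring

theorem hasSum_mul_of_summable_norm {ι κ : Type*} {f : ι → ℂ} {g : κ → ℂ} {y z : ℂ}
    (hf : Summable fun i => ‖f i‖) (hg : Summable fun i => ‖g i‖) (hy : HasSum f y)
    (hz : HasSum g z) (c : ℂ) : HasSum (fun x : ι × κ => c * (f x.1 * g x.2)) (c * (y * z)) :=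
  (hy.mul hz (summable_mul_of_summable_norm hf hg)).mul_left c

theorem hasSum_orbSum_mul_pow {O : Finset TwoTorsion} {h : ℕ} (hO : O.card = 2 * h) (hh : 2 ≤ h)
    (m : TwoTorsion →₀ ℕ) (τ : ℍ) :
    HasSum (fun n => orbSum m O n * qVar τ ^ n)
      (orbConst m * ((etaScale 2 τ ^ 24)⁻¹ * ∏ v, thetaMoment (decide (v ∈ O)) (m v) τ)) := by
  have hq : ‖qVar τ ^ 2‖ < 1 := by
    rw [norm_pow]
    exact pow_lt_one₀ (norm_nonneg _) (norm_qVar_lt_one τ) two_ne_zero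
  obtain ⟨hM1, hM2⟩ := hasSum_prod_momentCoeff O m τ
  have hprod := hasSum_mul_of_summable_norm (summable_norm_yauZaslow hq) hM1
    (hasSum_yauZaslow hq) hM2 (orbConst m * (qVar τ ^ 2)⁻¹)
  choose j hj using fun b : {b // oddSet b = O} => sum_sq_half_cast hO b.2
  -- Replaces the index `d` by `n = 2d - 2 + ½ ∑ b_v²`. The subtraction is exact as `h ≥ 2`, and
  -- pairs `(n, b)` outside the image have zero invariant, so the double series can be summed along
  -- fixed `n`.
  let ι : ℕ × {b // oddSet b = O} → ℕ × {b // oddSet b = O} :=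
    fun x => (2 * x.1 + (h + 2 * j x.2) - 2, x.2)
  have hinj : Function.Injective ι := by
    rintro ⟨d, b⟩ ⟨d', b'⟩ hdb
    simp only [ι, Prod.mk.injEq] at hdb
    obtain ⟨h1, rfl⟩ := hdb
    simp only [Prod.mk.injEq, and_true]
    omega
  have hterm (x : ℕ × {b // oddSet b = O}) :
      orbConst m * (qVar τ ^ 2)⁻¹ * (yauZaslow x.1 * (qVar τ ^ 2) ^ x.1 *
      ∏ v, momentCoeff (decide (v ∈ O)) (m v) (x.2.1 v) *
        cexp (π * I * (1 : ℕ) * (x.2.1 v : ℂ) ^ 2 * τ)) =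
      orbCoeff m (ι x).1 (ι x).2 * qVar τ ^ (ι x).1 :=
    orbCoeff_mul_pow hO hh x.2.2 (hj x.2) m τ x.1
  simp only [hterm] at hprod
  have hall := (hinj.hasSum_iff (f := fun y : ℕ × {b // oddSet b = O} =>
    orbCoeff m y.1 y.2 * qVar τ ^ y.1) fun y hy => by
      by_contra h0
      obtain ⟨d, hd⟩ := exists_of_k3Invariant_ne_zero
        (left_ne_zero_of_mul (left_ne_zero_of_mul (left_ne_zero_of_mul h0)))
      rw [hj y.2] at hd
      have h1 : y.1 + 2 = 2 * d + (h + 2 * j y.2) := by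
        have : (y.1 : ℚ) + 2 = 2 * d + (h + 2 * j y.2 : ℕ) := by linarith
        exact_mod_cast this
      refine hy ⟨(d, y.2), Prod.ext ?_ rfl⟩
      simp only [ι]
      omega).mp hprod
  have hfib := hall.prod_fiberwise fun n => (hasSum_orbSum m O n).mul_right (qVar τ ^ n)
  rw [etaScale_two_pow]
  convert! hfib using 1
  ring

end OrbifoldSeries

/-! ### Exponent count and the change of variables -/

section Quasimodularity

open Filter Topology Complex
open UpperHalfPlane hiding I
open scoped Real

/-- The function of `τ` given by `orbSum`, up to a constant. -/
def orbFun (m : TwoTorsion →₀ ℕ) (O : Finset TwoTorsion) (τ : ℍ) : ℂ :=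
  (etaScale 2 τ ^ 24)⁻¹ * ∏ v, thetaMoment (decide (v ∈ O)) (m v) τ

/-- For `x = η(2τ)`, `y = η(4τ)` the exponents are `2(16 - 2h) - 24 = -4(h - 2)` and `6h - (16 - 2h)
= 8(h - 2)`. The bounds on `h` make both natural subtractions exact. -/
theorem eta_monomial_eq {x y a b : ℂ} (hx : x ≠ 0) (hy : y ≠ 0) (ha : a * y = x ^ 2)
    (hb : b = 2 * I * y ^ 3) {h : ℕ} (h2 : 2 ≤ h) (h8 : h ≤ 8) :
    (x ^ 24)⁻¹ * (b ^ (2 * h) * a ^ (16 - 2 * h)) =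
      (2 * I) ^ (2 * h) * (y ^ 8 / x ^ 4) ^ (h - 2) := by
  have ha' : a = x ^ 2 / y := by rw [← ha, mul_div_cancel_right₀ _ hy]
  obtain ⟨k, rfl⟩ := Nat.exists_eq_add_of_le h2
  obtain ⟨l, hl⟩ := Nat.exists_eq_add_of_le h8
  have e1 : 16 - 2 * (2 + k) = 2 * l := by omega
  have e2 : 2 + k - 2 = k := by omega
  have e3 : k + l = 6 := by omega
  rw [e1, e2, ha', hb, mul_pow (2 * I), mul_assoc, mul_left_comm]
  congr 1
  rw [div_pow, div_pow]
  have hx24 : x ^ 24 = x ^ (4 * k) * x ^ (4 * l) := by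
    rw [← pow_add, ← mul_add, e3]
  rw [hx24]
  have hy24 : (y ^ 3) ^ (2 * (2 + k)) = y ^ (8 * k) * y ^ (2 * l) := by
    rw [← pow_mul, ← pow_add]
    congr 1
    omega
  rw [hy24]
  simp only [← pow_mul]
  have h3 : x ^ (4 * k) ≠ 0 := pow_ne_zero _ hx
  have h4 : x ^ (4 * l) ≠ 0 := pow_ne_zero _ hx
  have h5 : y ^ (2 * l) ≠ 0 := pow_ne_zero _ hy
  rw [show 2 * (2 * l) = 4 * l by ring]
  field_simp

theorem prod_thetaMoment_eq (m : TwoTorsion →₀ ℕ) (O : Finset TwoTorsion) :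
    ∃ r ∈ scaledRing, ∏ v, thetaMoment (decide (v ∈ O)) (m v) =
      r * (thetaMoment true 1 ^ O.card * thetaMoment false 0 ^ (16 - O.card)) := by
  have h (v : TwoTorsion) : ∃ r ∈ scaledRing, thetaMoment (decide (v ∈ O)) (m v) =
      r * if v ∈ O then thetaMoment true 1 else thetaMoment false 0 := by
    by_cases hv : v ∈ O
    · simpa [hv] using thetaMoment_true_eq (m v)
    · simpa [hv] using thetaMoment_false_eq (m v)
  choose r hr hrm using h
  refine ⟨∏ v, r v, Subalgebra.prod_mem _ fun v _ => hr v, ?_⟩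
  have hcard : Fintype.card TwoTorsion = 16 := by simp
  rw [Finset.prod_congr rfl fun v _ => hrm v, Finset.prod_mul_distrib, Finset.prod_ite,
    Finset.prod_const, Finset.prod_const, Finset.filter_not, Finset.filter_mem_eq_inter,
    Finset.univ_inter, ← Finset.compl_eq_univ_sdiff, Finset.card_compl, hcard]

theorem orbFun_mem (m : TwoTorsion →₀ ℕ) {O : Finset TwoTorsion} {h : ℕ} (hO : O.card = 2 * h)
    (h2 : 2 ≤ h) : orbFun m O ∈ quasimodularRing (CongruenceSubgroup.Gamma0 4) := by
  refine scaledRing_le ?_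
  obtain ⟨r, hr, hrm⟩ := prod_thetaMoment_eq m O
  have h8 : h ≤ 8 := by
    have := O.card_le_univ
    have hcard : Fintype.card TwoTorsion = 16 := by simp
    omega
  have : orbFun m O = r * ((2 * I) ^ (2 * h) • etaQuot ^ (h - 2)) := by
    funext τ
    have hA := congrFun thetaMoment_false_zero_mul τ
    have hB := congrFun thetaMoment_true_one τ
    simp only [Pi.mul_apply, Pi.pow_apply, Pi.smul_apply, smul_eq_mul] at hA hB
    have hP := congrFun hrm τ
    simp only [Finset.prod_apply, Pi.mul_apply, Pi.pow_apply] at hP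
    rw [orbFun, hP, hO, mul_left_comm, eta_monomial_eq (etaScale_ne_zero 2 τ)
      (etaScale_ne_zero 4 τ) hA hB h2 h8]
    rfl
  rw [this]
  exact Subalgebra.mul_mem _ hr (Subalgebra.smul_mem _
    (Subalgebra.pow_mem _ etaQuot_mem_scaledRing _) _)

/-- The coefficients of the orbifold potential in the variables `z_v` are quasimodular. -/
theorem exists_hasSum_coeff_orbPotential (s : ℤˣ) (m : TwoTorsion →₀ ℕ) :
    ∃ f ∈ quasimodularRing (CongruenceSubgroup.Gamma0 4), ∀ τ : ℍ,
      HasSum (fun n => MvPowerSeries.coeff m (orbPotential s n) * qVar τ ^ n) (f τ) := by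
  have hmem (O : Finset TwoTorsion) (hO : O ∈ oddSets false ∪ oddSets true) :
      ∃ h, O.card = 2 * h ∧ 2 ≤ h := by
    rcases Finset.mem_union.mp hO with h | h
    all_goals
      obtain ⟨h, h1, h2, -⟩ := card_of_mem_oddSets h
      exact ⟨h, h1, h2⟩
  refine ⟨∑ O ∈ oddSets false ∪ oddSets true,
    (((s : ℤ) : ℂ) ^ (O.card / 2) * orbConst m) • orbFun m O, ?_, fun τ => ?_⟩
  · refine Subalgebra.sum_mem _ fun O hO => Subalgebra.smul_mem _ ?_ _
    obtain ⟨h, h1, h2⟩ := hmem O hO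
    exact orbFun_mem m h1 h2
  · simp only [coeff_orbPotential, Finset.sum_mul, Finset.sum_apply, Pi.smul_apply, smul_eq_mul,
      mul_assoc]
    refine hasSum_sum fun O hO => ?_
    obtain ⟨h, h1, h2⟩ := hmem O hO
    exact (hasSum_orbSum_mul_pow h1 h2 m τ).mul_left _

theorem hasSubst_twoSinHalfInv : MvPowerSeries.HasSubst fun v : TwoTorsion =>
    PowerSeries.subst (MvPowerSeries.X v : MvPowerSeries TwoTorsion ℂ) twoSinHalfInv := by
  refine MvPowerSeries.hasSubst_of_constantCoeff_zero fun v => ?_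
  exact PowerSeries.constantCoeff_subst_eq_zero (MvPowerSeries.constantCoeff_X v) _
    (PowerSeries.constantCoeff_substInvOfIsUnit _ _)

/-- The change of variables replaces each coefficient by a finite linear combination. -/
theorem exists_coeff_subst_eq {a : TwoTorsion → MvPowerSeries TwoTorsion ℂ}
    (ha : MvPowerSeries.HasSubst a) (k : TwoTorsion →₀ ℕ) :
    ∃ (S : Finset (TwoTorsion →₀ ℕ)) (e : (TwoTorsion →₀ ℕ) → ℂ),
      ∀ f : MvPowerSeries TwoTorsion ℂ, MvPowerSeries.coeff k (MvPowerSeries.subst a f) =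
        ∑ m ∈ S, MvPowerSeries.coeff m f * e m := by
  set e : (TwoTorsion →₀ ℕ) → ℂ :=
    fun m => MvPowerSeries.coeff k (m.prod fun v j => (a v) ^ j) with he
  have hfin : (Function.support e).Finite := by
    -- Finiteness for the series with all coefficients 1 bounds the support of `e` itself, so one
    -- finite set serves every `f`, in particular every `n`.
    refine (MvPowerSeries.coeff_subst_finite ha (fun _ => 1 : MvPowerSeries TwoTorsion ℂ) k).subset
      fun m hm => ?_
    have h1 : MvPowerSeries.coeff m (fun _ => 1 : MvPowerSeries TwoTorsion ℂ) = 1 := rfl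
    rw [Function.mem_support, h1, one_smul]
    exact hm
  refine ⟨hfin.toFinset, e, fun f => ?_⟩
  rw [MvPowerSeries.coeff_subst ha]
  refine finsum_eq_sum_of_support_subset _ fun m hm => ?_
  rw [Set.Finite.coe_toFinset]
  exact right_ne_zero_of_mul hm

end Quasimodularity

end HyperellipticCount

end

theorem mainTheorem3 (s : ℤˣ) (k : HyperellipticCount.TwoTorsion →₀ ℕ) :
    HyperellipticCount.IsQuasimodular (CongruenceSubgroup.Gamma0 4)
      (HyperellipticCount.monomialCoeff s k) := by
  obtain ⟨S, e, hS⟩ := HyperellipticCount.exists_coeff_subst_eq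
    HyperellipticCount.hasSubst_twoSinHalfInv k
  choose f hf hsum using HyperellipticCount.exists_hasSum_coeff_orbPotential s
  refine ⟨∑ m ∈ S, e m • f m, Subalgebra.sum_mem _ fun m _ => Subalgebra.smul_mem _ (hf m) _,
    fun τ => ?_⟩
  simp only [HyperellipticCount.monomialCoeff, HyperellipticCount.F, PowerSeries.coeff_mk, hS,
    Finset.sum_mul, Finset.sum_apply, Pi.smul_apply, smul_eq_mul]
  refine hasSum_sum fun m _ => ?_
  convert! (hsum m τ).mul_left (e m) using 2 with n
  rw [HyperellipticCount.qVar]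
  ring
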